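/- Let $p\ge 0$ be an integer. There are constants $b>0$ and $c,C>0$, depending only on $p$, such that the following holds for the fixed polynomial kernel $k(z,z')=(\langle z,z'\rangle+b)^p$. Let $d,r\ge 0$ be integers, let $U\in\mathbb R^{r\times d}$, let $\mu$ be a probability law on $\mathbb R^d$ with a density $\rho$, and let $X=(x_1,\dots,x_n)$ be $n$ independent samples from $\mu$. Let $\mathcal F_{p,U}$ be the set of polynomials $f:\mathbb R^d\to\mathbb R$ of total degree $p$ of the form $f(x)=g(Ux)$ with $g:\mathbb R^r\to\mathbb R$. For $h:\mathbb R^d\to\mathbb R$ put $R(h,f)=\mathbb E_{x\sim\mu}[(h(x)-f(x))^2]\in[0,\infty]$. Labels are noiseless: $y_i=f(x_i)$. **Upper bound.** Let $f\in\mathcal F_{p,U}$ with $\mathbb E_{x\sim\mu}\|\nabla f(x)\|^2<\infty$, and let $M=\mathbb E_{x\sim\mu}[\nabla f(x)\nabla f(x)^T]$. For $\lambda\ge 0$, a kernel ridge regression estimator on the transformed data $(M^{1/2}x_i,y_i)_{i\le n}$ is a minimizer $F$ of $$\sum_{i=1}^n\bigl(F(M^{1/2}x_i)-y_i\bigr)^2+\lambda\|F\|_{\mathcal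 H}^2$$ over the reproducing kernel Hilbert space $\mathcal H$ on $\mathbb R^d$ of $k$. If $n\ge C\,r^p$, then almost surely: 1. a minimizer exists for every $\lambda\ge 0$; 2. for $\lambda=0$ every minimizer $F$ recovers the target exactly, $F(M^{1/2}x)=f(x)$ for all $x\in\mathbb R^d$; 3. if $F_\lambda$ is a minimizer for each $\lambda>0$, then $F_\lambda(M^{1/2}x)\to f(x)$ as $\lambda\to0^+$ for every $x\in\mathbb R^d$; if moreover $\mathbb E_{x\sim\mu}\|x\|^{2p}<\infty$, then also $R\bigl(F_\lambda(M^{1/2}\,\cdot\,),f\bigr)\to0$ as $\lambda\to 0^+$. **Minimax lower bound.** Suppose $r\ge1$, $\operatorname{rank}U=r$ and $\mathbb E_{x\sim\mu}\|x\|^{2p}<\infty$. If $n\le c\,r^p$, then for every (jointly measurable) estimator $A$, which maps the data $(x_i,f(x_i))_{i\le n}$ to a function on $\mathbb R^d$ and may depend on $U$ and $\rho$, there is $f\in\mathcal F_{p,U}$ with $R(0,f)=1$ and $$\mathbb E_X\,R\bigl(A((x_i,f(x_i))_{i\le n}),f\bigr)\ \ge\ \tfrac12 .$$ Thus $O(r^p)$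 samples suffice for kernel ridge regression on $M^{1/2}X$, uniformly in $d$, $U$, $\rho$ and $f$, and this order in $r$ is minimax optimal over $\mathcal F_{p,U}$. -/

import Mathlib

open MeasureTheory Filter Topology
open scoped Gradient Matrix

/-- `f : ℝ^d → ℝ` is a polynomial of degree `p` of rank `r` with respect to the matrix
`U ∈ ℝ^{r × d}`: it is a polynomial of total degree `p` and `f x = g (U x)` for some `g`. -/
def IsLowRankPoly (p : ℕ) {d r : ℕ} (U : Matrix (Fin r) (Fin d) ℝ)
    (f : EuclideanSpace ℝ (Fin d) → ℝ) : Prop :=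
  (∃ P : MvPolynomial (Fin d) ℝ, P.totalDegree = p ∧
      ∀ x, f x = MvPolynomial.eval (fun i => x i) P) ∧
  ∃ g : (Fin r → ℝ) → ℝ, ∀ x, f x = g (U *ᵥ (fun i => x i))

/-- The probability law on `ℝ^d` with density `ρ` with respect to Lebesgue measure. -/
noncomputable def densityLaw {d : ℕ} (ρ : EuclideanSpace ℝ (Fin d) → ENNReal) :
    Measure (EuclideanSpace ℝ (Fin d)) :=
  (volume : Measure (EuclideanSpace ℝ (Fin d))).withDensity ρ

/-- The law of `n` independent samples from `μ`. -/
noncomputable def sampleLaw {d : ℕ} (n : ℕ) (μ : Measure (EuclideanSpace ℝ (Fin d))) :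
    Measure (Fin n → EuclideanSpace ℝ (Fin d)) :=
  Measure.pi (fun _ => μ)

/-- The expected gradient outer product `M = 𝔼_{x ∼ μ} [∇f(x) ∇f(x)ᵀ]`. -/
noncomputable def egop {d : ℕ} (μ : Measure (EuclideanSpace ℝ (Fin d)))
    (f : EuclideanSpace ℝ (Fin d) → ℝ) : Matrix (Fin d) (Fin d) ℝ :=
  Matrix.of fun i j => ∫ x, (∇ f x) i * (∇ f x) j ∂μ

open scoped MatrixOrder Matrix.Norms.L2Operator in
/-- The data transformation `x ↦ M^{1/2} x`, with `M^{1/2}` the positive semidefinite square root. -/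
noncomputable def sqrtTransform {d : ℕ} (M : Matrix (Fin d) (Fin d) ℝ)
    (x : EuclideanSpace ℝ (Fin d)) : EuclideanSpace ℝ (Fin d) :=
  WithLp.toLp 2 (CFC.sqrt M *ᵥ (fun i => x i))

/-- The polynomial kernel `k(z, z') = (⟨z, z'⟩ + b)^p`. -/
noncomputable def polyKernel (d : ℕ) (b : NNReal) (p : ℕ) (z z' : EuclideanSpace ℝ (Fin d)) : ℝ :=
  (inner ℝ z z' + (b : ℝ)) ^ p

/-- The polynomial kernel as an operator-valued kernel: the value `k(z, z')` acts on `ℝ` by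
multiplication. -/
noncomputable def polyKernelMatrix (d : ℕ) (b : NNReal) (p : ℕ) :
    Matrix (EuclideanSpace ℝ (Fin d)) (EuclideanSpace ℝ (Fin d)) (ℝ →L[ℝ] ℝ) :=
  Matrix.of fun z z' => polyKernel d b p z z' • ContinuousLinearMap.id ℝ ℝ

theorem polyKernel_features (d : ℕ) (b : NNReal) (p : ℕ) :
    ∃ (N : ℕ) (φ : Fin N → EuclideanSpace ℝ (Fin d) → ℝ),
      ∀ z z', polyKernel d b p z z' = ∑ a, φ a z * φ a z' := by
  suffices h : ∃ (ι : Type) (_ : Fintype ι) (φ : ι → EuclideanSpace ℝ (Fin d) → ℝ),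
      ∀ z z', polyKernel d b p z z' = ∑ a, φ a z * φ a z' by
    obtain ⟨ι, _, φ, h⟩ := h
    refine ⟨Fintype.card ι, fun a => φ ((Fintype.equivFin ι).symm a), fun z z' => ?_⟩
    rw [h, ← Equiv.sum_comp (Fintype.equivFin ι).symm]
  induction p with
  | zero => exact ⟨Unit, inferInstance, fun _ _ => 1, fun z z' => by simp [polyKernel]⟩
  | succ p ih =>
    obtain ⟨ι, _, φ, h⟩ := ih
    let ψ : Option (Fin d) → EuclideanSpace ℝ (Fin d) → ℝ := fun o z =>
      match o with
      | none => Real.sqrt b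
      | some i => z i
    have hψ : ∀ z z', inner ℝ z z' + (b : ℝ) = ∑ o, ψ o z * ψ o z' := by
      intro z z'
      have hb : Real.sqrt (b : ℝ) * Real.sqrt (b : ℝ) = b := Real.mul_self_sqrt b.2
      simp only [Fintype.sum_option, ψ, hb, PiLp.inner_apply]
      rw [add_comm]
      congr 1
      exact Finset.sum_congr rfl fun i _ => by simp [mul_comm]
    refine ⟨ι × Option (Fin d), inferInstance, fun a z => φ a.1 z * ψ a.2 z, fun z z' => ?_⟩
    have : polyKernel d b (p + 1) z z' = polyKernel d b p z z' * (inner ℝ z z' + (b : ℝ)) := by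
      simp [polyKernel, pow_succ]
    rw [this, h, hψ, Fintype.sum_mul_sum, Fintype.sum_prod_type]
    exact Finset.sum_congr rfl fun a _ => Finset.sum_congr rfl fun o _ => by ring

open scoped ComplexOrder in
theorem polyKernelMatrix_posSemidef (d : ℕ) (b : NNReal) (p : ℕ) :
    (polyKernelMatrix d b p).PosSemidef := by
  obtain ⟨N, φ, h⟩ := polyKernel_features d b p
  have key := (RKHS.posSemidef_tfae (K := polyKernelMatrix d b p)).out 0 2
  refine key.mpr (And.intro ?_ fun vv => ?_)
  · ext z z'
    have hid : ContinuousLinearMap.adjoint (ContinuousLinearMap.id ℝ ℝ) =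
        ContinuousLinearMap.id ℝ ℝ := star_one (ℝ →L[ℝ] ℝ)
    simp [polyKernelMatrix, polyKernel, real_inner_comm, star, Matrix.conjTranspose_apply, hid]
  · have : (vv.sum fun x w => vv.sum fun x' w' =>
        inner ℝ (polyKernelMatrix d b p x' x w) w') =
        ∑ a, (vv.sum fun x w => w * φ a x) ^ 2 := by
      simp only [Finsupp.sum, polyKernelMatrix, Matrix.of_apply, h, sq, Finset.sum_mul_sum]
      rw [Finset.sum_comm]
      refine (Finset.sum_congr rfl fun x _ => ?_).trans Finset.sum_comm
      rw [Finset.sum_comm]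
      refine Finset.sum_congr rfl fun x' _ => ?_
      simp [Finset.sum_mul, Finset.mul_sum]
      exact Finset.sum_congr rfl fun a _ => by ring
    rw [this, RCLike.re_to_real]
    exact Finset.sum_nonneg (f := fun a => (vv.sum fun x w => w * φ a x) ^ 2)
      fun a _ => sq_nonneg _

open scoped ComplexOrder in
instance polyKernelMatrix_fact (d : ℕ) (b : NNReal) (p : ℕ) :
    Fact (polyKernelMatrix d b p).PosSemidef :=
  ⟨polyKernelMatrix_posSemidef d b p⟩

/-- The reproducing kernel Hilbert space on `ℝ^d` of the polynomial kernel. -/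
abbrev PolyRKHS (d : ℕ) (b : NNReal) (p : ℕ) : Type :=
  RKHS.OfKernel (polyKernelMatrix d b p)

/-- `F` is a kernel ridge regression estimator in the RKHS `H` with ridge parameter `lam ≥ 0` on the
data set `(Z i, y i)`: it minimizes `∑ i, (F (Z i) - y i)^2 + lam * ‖F‖^2` over `H`. -/
def IsKernelRidge {X H : Type*} [NormedAddCommGroup H] [InnerProductSpace ℝ H] [RKHS ℝ H X ℝ]
    {n : ℕ} (lam : ℝ) (Z : Fin n → X) (y : Fin n → ℝ) (F : H) : Prop :=
  ∀ G : H, ∑ i, (F (Z i) - y i) ^ 2 + lam * ‖F‖ ^ 2 ≤ ∑ i, (G (Z i) - y i) ^ 2 + lam * ‖G‖ ^ 2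

/-- The squared prediction error `𝔼_{x ∼ μ} (h x - f x)^2`. -/
noncomputable def predictionRisk {d : ℕ} (μ : Measure (EuclideanSpace ℝ (Fin d)))
    (h f : EuclideanSpace ℝ (Fin d) → ℝ) : ENNReal :=
  ∫⁻ x, ENNReal.ofReal ((h x - f x) ^ 2) ∂μ

/-!
**Upper bound.** Put `M = 𝔼 ∇f ∇fᵀ` and `T = M^{1/2}`. The quadratic form of `M` at `v` is the mean
square of the polynomial `∂_v f`, and a nonzero polynomial is nonzero almost everywhere
(`MvPolynomial.ae_eval_ne_zero`). So `ker T` consists of the directions along which `f` is constant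
(`sqrtTransform_egop_eq_zero_iff`), it contains `ker U`, and `T` has some rank `s ≤ r`. Two facts
about the RKHS of the kernel `(⟪z, z'⟫ + b) ^ p` then reduce the claim to linear algebra. First, the
functions `x ↦ F (T x)` lie in a space `S` of polynomials with `dim S ≤ (s + 1) ^ p`
(`exists_submodule_polyRKHS_comp_mem`): expand `(⟪x, T z⟫ + b) ^ p` in an orthonormal basis of the
range of `T`. Second, `f` itself is of this form (`exists_polyRKHS_comp_eq`): expanding the functions
`x ↦ (⟪x, w + t u⟫ + b) ^ p` in `t` yields all products of at most `p` linear forms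
`⟪x, wᵢ⟫` with `wᵢ` in the range of `T`. As `(s + 1) ^ p ≤ (2 r) ^ p ≤ n`, a random sample almost surely
determines the elements of `S` through a Lagrange interpolation formula (`ae_exists_lagrange`). The
error `F (T x) - f x` is therefore a fixed linear combination of the training residuals, which
vanish for `λ = 0` and are `O(√λ)` for `λ > 0`.

**Lower bound.** The homogeneous polynomials of degree `p` in `U x` form a space of dimension
`N ≥ r ^ p / p!` all of whose nonzero elements belong to the class. Identify it with `ℝ^N` through
an orthonormal basis of `L²(μ)`, and draw `θ` from a rotation invariant law on the unit sphere. For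
a given sample let `K` be the subspace of those `θ` whose polynomial vanishes on the sample, so that
`dim K ≥ N - n ≥ N / 2`. Changing the sign of the component of `θ` in `K` changes neither the data nor
the prior, so the average risk of any estimator is at least the mean square of that component,
which is `dim K / N ≥ 1 / 2` (`half_le_lintegral_prior`). Averaging over the samples and exchanging
the integrals gives some `θ` of unit norm with risk at least `1 / 2`
(`exists_half_le_lintegral_risk`).
-/

/-! ### Zero sets of polynomials -/

/-- A measurable property of `n + 1` independent points holds almost surely if, for almost all
values of the last `n` points, it holds for almost every first point. -/
theorem ae_pi_of_ae_cons {α : Type*} [MeasurableSpace α] (μ : Measure α) [SigmaFinite μ] {n : ℕ}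
    {P : (Fin (n + 1) → α) → Prop} (hP : MeasurableSet {x | P x})
    (h : ∀ᵐ y ∂Measure.pi (fun _ : Fin n => μ), ∀ᵐ t ∂μ, P (Fin.cons t y)) :
    ∀ᵐ x ∂Measure.pi (fun _ : Fin (n + 1) => μ), P x := by
  have hmp := (measurePreserving_piFinSuccAbove (fun _ : Fin (n + 1) => μ) 0).symm
  have hmeas : Measurable fun z : (Fin n → α) × α => (Fin.cons z.2 z.1 : Fin (n + 1) → α) :=
    measurable_pi_iff.mpr fun i => by
      refine Fin.cases ?_ (fun j => ?_) i
      · simpa using measurable_snd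
      · exact (measurable_pi_apply j).comp measurable_fst
  have h1 : ∀ᵐ z ∂(Measure.pi (fun _ : Fin n => μ)).prod μ, P (Fin.cons z.2 z.1) :=
    (Measure.ae_prod_iff_ae_ae (p := fun z : (Fin n → α) × α => P (Fin.cons z.2 z.1))
      (hmeas hP)).mpr h
  have h2 : ∀ᵐ z ∂μ.prod (Measure.pi (fun _ : Fin n => μ)), P (Fin.cons z.1 z.2) := by
    rw [← Measure.prod_swap]
    refine (ae_map_iff measurable_swap.aemeasurable ?_).mpr h1
    exact (hmeas.comp measurable_swap) hP
  rw [← hmp.map_eq]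
  refine (ae_map_iff hmp.measurable.aemeasurable hP).mpr ?_
  filter_upwards [h2] with z hz
  simpa [MeasurableEquiv.piFinSuccAbove_symm_apply, Fin.insertNthEquiv] using hz

/-- The zero set of a nonzero polynomial is a Lebesgue null set. In the first variable, the
polynomial has finitely many roots unless its leading coefficient vanishes at the other ones. -/
theorem MvPolynomial.ae_eval_ne_zero {d : ℕ} (P : MvPolynomial (Fin d) ℝ) (hP : P ≠ 0) :
    ∀ᵐ x : Fin d → ℝ, MvPolynomial.eval x P ≠ 0 := by
  induction d with
  | zero =>
    obtain ⟨x, hx⟩ : ∃ x, MvPolynomial.eval x P ≠ 0 := by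
      by_contra! h
      exact hP (MvPolynomial.funext fun x => by simp [h x])
    exact Filter.Eventually.of_forall fun y => Subsingleton.elim x y ▸ hx
  | succ d ih =>
    set Q := MvPolynomial.finSuccEquiv ℝ d P with hQ
    have hQ0 : Q ≠ 0 := by simpa [hQ] using hP
    refine ae_pi_of_ae_cons volume ?_ ?_
    · exact (measurableSet_eq_fun (MvPolynomial.continuous_eval P).measurable
        measurable_const).compl
    · filter_upwards [ih Q.leadingCoeff (by simpa using hQ0)] with y hy
      have hmap : Q.map (MvPolynomial.eval y) ≠ 0 := fun h0 => hy (by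
        have := congrArg (fun R => R.coeff Q.natDegree) h0
        simpa [Polynomial.coeff_map] using this)
      have hfin : {t : ℝ | (Q.map (MvPolynomial.eval y)).IsRoot t}.Finite :=
        Polynomial.finite_setOfPred_isRoot hmap
      filter_upwards [measure_eq_zero_iff_ae_notMem.mp (hfin.measure_zero volume)] with t ht
      rw [MvPolynomial.eval_eq_eval_mv_eval']
      exact ht

/-! ### Polynomial functions on Euclidean space -/

/-- Evaluation of polynomials in `d` variables as functions on `ℝ^d`, as a linear map. -/
noncomputable def evalFun (d : ℕ) :
    MvPolynomial (Fin d) ℝ →ₗ[ℝ] (EuclideanSpace ℝ (Fin d) → ℝ) where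
  toFun P := fun x => MvPolynomial.eval (fun i => x i) P
  map_add' P Q := by ext x; simp
  map_smul' c P := by ext x; simp

@[simp] theorem evalFun_apply {d : ℕ} (P : MvPolynomial (Fin d) ℝ) (x : EuclideanSpace ℝ (Fin d)) :
    evalFun d P x = MvPolynomial.eval (fun i => x i) P := rfl

/-- The space of polynomial functions of degree at most `p` on `ℝ^d`. -/
noncomputable def polyFun (d p : ℕ) : Submodule ℝ (EuclideanSpace ℝ (Fin d) → ℝ) :=
  (MvPolynomial.restrictTotalDegree (Fin d) ℝ p).map (evalFun d)

theorem mem_polyFun {d p : ℕ} {f : EuclideanSpace ℝ (Fin d) → ℝ} :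
    f ∈ polyFun d p ↔ ∃ P : MvPolynomial (Fin d) ℝ, P.totalDegree ≤ p ∧ evalFun d P = f := by
  simp [polyFun, Submodule.mem_map, MvPolynomial.mem_restrictTotalDegree]

theorem ae_evalFun_ne_zero {d : ℕ} (P : MvPolynomial (Fin d) ℝ) (hP : evalFun d P ≠ 0) :
    ∀ᵐ x : EuclideanSpace ℝ (Fin d), evalFun d P x ≠ 0 := by
  have hP0 : P ≠ 0 := fun h => hP (by simp [h])
  exact (PiLp.volume_preserving_ofLp (Fin d)).quasiMeasurePreserving.ae
    (MvPolynomial.ae_eval_ne_zero P hP0)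

theorem mul_mem_polyFun {d p q : ℕ} {f g : EuclideanSpace ℝ (Fin d) → ℝ}
    (hf : f ∈ polyFun d p) (hg : g ∈ polyFun d q) : f * g ∈ polyFun d (p + q) := by
  obtain ⟨P, hP, rfl⟩ := mem_polyFun.mp hf
  obtain ⟨Q, hQ, rfl⟩ := mem_polyFun.mp hg
  refine mem_polyFun.mpr ⟨P * Q, (MvPolynomial.totalDegree_mul _ _).trans (by omega), ?_⟩
  ext x; simp

theorem const_mem_polyFun {d : ℕ} (p : ℕ) (c : ℝ) : (fun _ => c) ∈ polyFun d p :=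
  mem_polyFun.mpr ⟨MvPolynomial.C c, by simp, by ext x; simp⟩

theorem coord_mem_polyFun {d : ℕ} (i : Fin d) : (fun x => x i) ∈ polyFun d 1 :=
  mem_polyFun.mpr ⟨MvPolynomial.X i, by simp, by ext x; simp⟩

theorem inner_mem_polyFun {d : ℕ} (w : EuclideanSpace ℝ (Fin d)) :
    (fun x => inner ℝ x w) ∈ polyFun d 1 := by
  have : (fun x : EuclideanSpace ℝ (Fin d) => inner ℝ x w) = ∑ i, w i • fun x => x i := by
    ext x; simp [PiLp.inner_apply]
  rw [this]
  exact Submodule.sum_mem _ fun i _ => Submodule.smul_mem _ _ (coord_mem_polyFun i)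

theorem prod_mem_polyFun {d : ℕ} {ι : Type*} (s : Finset ι)
    (f : ι → EuclideanSpace ℝ (Fin d) → ℝ) (hf : ∀ i ∈ s, f i ∈ polyFun d 1) :
    ∏ i ∈ s, f i ∈ polyFun d s.card := by
  classical
  induction s using Finset.induction_on with
  | empty => exact const_mem_polyFun 0 (1 : ℝ)
  | insert a s ha ih =>
    rw [Finset.prod_insert ha, Finset.card_insert_of_notMem ha, add_comm]
    exact mul_mem_polyFun (hf a (by simp)) (ih fun i hi => hf i (by simp [hi]))

theorem contDiff_evalFun {d : ℕ} (P : MvPolynomial (Fin d) ℝ) : ContDiff ℝ 1 (evalFun d P) := by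
  induction P using MvPolynomial.induction_on with
  | C a =>
    have : evalFun d (MvPolynomial.C a) = fun _ => a := by ext; simp
    exact this ▸ contDiff_const
  | add P Q hP hQ => rw [map_add]; exact hP.add hQ
  | mul_X P i hP =>
    have h : ContDiff ℝ 1 fun x : EuclideanSpace ℝ (Fin d) => x i := by fun_prop
    have h1 : evalFun d (P * MvPolynomial.X i) = fun x => evalFun d P x * x i := by ext; simp
    exact h1 ▸ hP.mul h

theorem continuous_of_mem_polyFun {d p : ℕ} {f : EuclideanSpace ℝ (Fin d) → ℝ}
    (hf : f ∈ polyFun d p) : Continuous f := by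
  obtain ⟨P, -, rfl⟩ := mem_polyFun.mp hf
  exact (contDiff_evalFun P).continuous

/-- A directional derivative of a polynomial function is a polynomial function. -/
theorem exists_fderiv_evalFun {d : ℕ} (P : MvPolynomial (Fin d) ℝ) (v : EuclideanSpace ℝ (Fin d)) :
    ∃ Q : MvPolynomial (Fin d) ℝ, ∀ x, fderiv ℝ (evalFun d P) x v = evalFun d Q x := by
  have hd : ∀ P : MvPolynomial (Fin d) ℝ, Differentiable ℝ (evalFun d P) :=
    fun P => (contDiff_evalFun P).differentiable (by simp)
  induction P using MvPolynomial.induction_on with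
  | C a =>
    refine ⟨0, fun x => ?_⟩
    have : evalFun d (MvPolynomial.C a) = fun _ => a := by ext; simp
    simp [this]
  | add P Q hP hQ =>
    obtain ⟨P', hP'⟩ := hP
    obtain ⟨Q', hQ'⟩ := hQ
    refine ⟨P' + Q', fun x => ?_⟩
    rw [map_add, fderiv_add (hd P x) (hd Q x)]
    simp only [add_apply, hP', hQ', map_add, Pi.add_apply]
  | mul_X P i hP =>
    obtain ⟨P', hP'⟩ := hP
    refine ⟨P * MvPolynomial.C (v i) + MvPolynomial.X i * P', fun x => ?_⟩
    have h1 : evalFun d (P * MvPolynomial.X i) =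
        evalFun d P * (EuclideanSpace.proj i : EuclideanSpace ℝ (Fin d) →L[ℝ] ℝ) := by
      ext x; simp
    rw [h1, fderiv_mul (hd P x) (ContinuousLinearMap.differentiableAt _),
      ContinuousLinearMap.fderiv]
    simp [hP']

/-- A polynomial function of degree at most `p` grows at most like `1 + ‖x‖ ^ p`. -/
theorem exists_abs_le_of_mem_polyFun {d p : ℕ} {f : EuclideanSpace ℝ (Fin d) → ℝ}
    (hf : f ∈ polyFun d p) : ∃ B : ℝ, 0 ≤ B ∧ ∀ x, |f x| ≤ B * (1 + ‖x‖ ^ p) := by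
  obtain ⟨P, hP, rfl⟩ := mem_polyFun.mp hf
  refine ⟨∑ m ∈ P.support, |P.coeff m|, Finset.sum_nonneg fun _ _ => abs_nonneg _, fun x => ?_⟩
  rw [evalFun_apply, MvPolynomial.eval_eq, Finset.sum_mul]
  refine (Finset.abs_sum_le_sum_abs _ _).trans (Finset.sum_le_sum fun m hm => ?_)
  rw [abs_mul]
  refine mul_le_mul_of_nonneg_left ?_ (abs_nonneg _)
  have hdeg : ∑ i ∈ m.support, m i ≤ p := (MvPolynomial.le_totalDegree hm).trans hP
  calc |∏ i ∈ m.support, x i ^ m i| = ∏ i ∈ m.support, |x i| ^ m i := by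
        rw [Finset.abs_prod]; simp [abs_pow]
    _ ≤ ∏ i ∈ m.support, ‖x‖ ^ m i := by
        gcongr with i _
        simpa using PiLp.norm_apply_le x i
    _ = ‖x‖ ^ (∑ i ∈ m.support, m i) := Finset.prod_pow_eq_pow_sum _ _ _
    _ ≤ 1 + ‖x‖ ^ p := by
        rcases le_total ‖x‖ 1 with h | h
        · exact (pow_le_one₀ (norm_nonneg _) h).trans (by simp)
        · exact (pow_le_pow_right₀ h hdeg).trans (by simp)

theorem integrable_sq_of_mem_polyFun {d p : ℕ} {f : EuclideanSpace ℝ (Fin d) → ℝ}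
    (hf : f ∈ polyFun d p) {μ : Measure (EuclideanSpace ℝ (Fin d))} [IsFiniteMeasure μ]
    (hμ : Integrable (fun x => ‖x‖ ^ (2 * p)) μ) : Integrable (fun x => f x ^ 2) μ := by
  obtain ⟨B, hB, h⟩ := exists_abs_le_of_mem_polyFun hf
  refine Integrable.mono' (g := fun x => 2 * B ^ 2 * (1 + ‖x‖ ^ (2 * p)))
    (((integrable_const _).add hμ).const_mul _)
    ((continuous_of_mem_polyFun hf).pow 2).aestronglyMeasurable
    (Filter.Eventually.of_forall fun x => ?_)
  have h1 : f x ^ 2 ≤ (B * (1 + ‖x‖ ^ p)) ^ 2 := by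
    rw [← sq_abs]
    exact pow_le_pow_left₀ (abs_nonneg _) (h x) 2
  rw [Real.norm_of_nonneg (sq_nonneg _), pow_mul']
  nlinarith [mul_nonneg (sq_nonneg B) (sq_nonneg (1 - ‖x‖ ^ p))]

/-! ### Random samples are unisolvent -/

/-- If every nontrivial combination of `q₁, …, qₘ` is nonzero almost everywhere, then the
generalized Vandermonde determinant `det (q_a (x_i))` of `m` independent points is almost surely
nonzero. -/
theorem ae_det_ne_zero {α : Type*} [MeasurableSpace α] (μ : Measure α) [SigmaFinite μ] {m : ℕ}
    (q : Fin m → α → ℝ) (hm : ∀ a, Measurable (q a))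
    (hq : ∀ c : Fin m → ℝ, c ≠ 0 → ∀ᵐ x ∂μ, ∑ a, c a * q a x ≠ 0) :
    ∀ᵐ X ∂Measure.pi (fun _ : Fin m => μ), (Matrix.of fun i a => q a (X i)).det ≠ 0 := by
  induction m with
  | zero => exact Filter.Eventually.of_forall fun X => by simp
  | succ m ih =>
    refine ae_pi_of_ae_cons μ ?_ ?_
    · refine (measurableSet_eq_fun ?_ measurable_const).compl
      simp only [Matrix.det_apply, Matrix.of_apply]
      refine Finset.measurable_sum _ fun σ _ => Measurable.const_smul ?_ _
      exact Finset.measurable_prod _ fun i _ => (hm _).comp (measurable_pi_apply _)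
    · have h0 := ih (fun a => q a.succ) (fun a => hm _) fun c hc => by
        have hc' : (Fin.cons 0 c : Fin (m + 1) → ℝ) ≠ 0 := fun h => hc (by
          ext a; simpa using congrFun h a.succ)
        simpa [Fin.sum_univ_succ] using hq _ hc'
      filter_upwards [h0] with y hy
      -- The cofactors along the first row do not depend on the first point.
      set c : Fin (m + 1) → ℝ := fun j =>
        (-1) ^ (j : ℕ) * (Matrix.of fun i a => q (j.succAbove a) (y i)).det with hc
      have hc0 : c ≠ 0 := fun h => hy (by simpa [hc] using congrFun h 0)
      filter_upwards [hq c hc0] with t ht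
      convert ht using 1
      rw [Matrix.det_succ_row_zero]
      refine Finset.sum_congr rfl fun j _ => ?_
      simp only [hc, Matrix.of_apply, Fin.cons_zero]
      rw [mul_right_comm]
      congr 2

/-- A combination of `m` functions that vanishes on a random sample of `n ≥ m` points is trivial;
the points beyond `m` of them only add equations. -/
theorem ae_forall_eq_zero_of_sample {α : Type*} [MeasurableSpace α] (μ : Measure α)
    [SigmaFinite μ] {m n : ℕ} (hmn : m ≤ n) (q : Fin m → α → ℝ) (hm : ∀ a, Measurable (q a))
    (hq : ∀ c : Fin m → ℝ, c ≠ 0 → ∀ᵐ x ∂μ, ∑ a, c a * q a x ≠ 0) :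
    ∀ᵐ X ∂Measure.pi (fun _ : Fin n => μ),
      ∀ c : Fin m → ℝ, (∀ i, ∑ a, c a * q a (X i) = 0) → c = 0 := by
  induction n, hmn using Nat.le_induction with
  | base =>
    filter_upwards [ae_det_ne_zero μ q hm hq] with X hX c hc
    refine Matrix.eq_zero_of_mulVec_eq_zero hX ?_
    ext i
    simpa [Matrix.mulVec, dotProduct, mul_comm] using hc i
  | succ n _ ih =>
    have hmp := (measurePreserving_piFinSuccAbove (fun _ : Fin (n + 1) => μ) 0)
    have hq := (Measure.quasiMeasurePreserving_snd.comp hmp.quasiMeasurePreserving).ae ih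
    filter_upwards [hq] with X hX c hc
    refine hX c fun i => ?_
    exact hc i.succ

/-- Lagrange interpolation from a random sample: if `S` is a space of polynomial functions of
dimension at most `n`, then almost surely every `g ∈ S` is recovered from its values at `n` points
sampled from an absolutely continuous law, by a formula linear in these values. -/
theorem ae_exists_lagrange {d p n : ℕ} (μ : Measure (EuclideanSpace ℝ (Fin d))) [SigmaFinite μ]
    (hμ : μ ≪ volume) {S : Submodule ℝ (EuclideanSpace ℝ (Fin d) → ℝ)} [FiniteDimensional ℝ S]
    (hS : S ≤ polyFun d p) (hn : Module.finrank ℝ S ≤ n) :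
    ∀ᵐ X ∂Measure.pi (fun _ : Fin n => μ), ∃ ℓ : Fin n → EuclideanSpace ℝ (Fin d) → ℝ,
      (∀ i, ℓ i ∈ S) ∧ ∀ g ∈ S, g = ∑ i, g (X i) • ℓ i := by
  let B := Module.finBasis ℝ S
  have hB : ∀ (c : Fin (Module.finrank ℝ S) → ℝ) x,
      ((∑ a, c a • B a : S) : EuclideanSpace ℝ (Fin d) → ℝ) x = ∑ a, c a * (B a).1 x := by
    intro c x
    simp
  have key := ae_forall_eq_zero_of_sample μ hn (fun a => (B a).1)
    (fun a => (continuous_of_mem_polyFun (hS (B a).2)).measurable) fun c hc => by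
      have hne : (∑ a, c a • B a : S) ≠ 0 := fun h => hc (by
        ext a
        exact Fintype.linearIndependent_iff.mp B.linearIndependent c h a)
      obtain ⟨P, -, hP⟩ := mem_polyFun.mp (hS (∑ a, c a • B a : S).2)
      have h0 : evalFun d P ≠ 0 := by
        rw [hP]; exact fun h => hne (Subtype.ext h)
      filter_upwards [hμ.ae_le (ae_evalFun_ne_zero P h0)] with x hx
      rwa [hP, hB] at hx
  filter_upwards [key] with X hX
  let ev : S →ₗ[ℝ] (Fin n → ℝ) :=
    { toFun := fun g i => g.1 (X i)
      map_add' := fun g h => by ext; simp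
      map_smul' := fun c g => by ext; simp }
  have hker : LinearMap.ker ev = ⊥ := by
    refine LinearMap.ker_eq_bot'.mpr fun g hg => ?_
    have h1 : g = ∑ a, B.repr g a • B a := (B.sum_repr g).symm
    have h2 : (fun a => B.repr g a) = 0 := hX _ fun i => by
      rw [← hB, ← h1]
      exact congrFun hg i
    rw [h1]
    exact Finset.sum_eq_zero fun a _ => by rw [show B.repr g a = 0 from congrFun h2 a, zero_smul]
  obtain ⟨L, hL⟩ := ev.exists_leftInverse_of_injective hker
  refine ⟨fun i => (L (Pi.single i 1)).1, fun i => (L _).2, fun g hg => ?_⟩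
  have h3 : L (ev ⟨g, hg⟩) = ⟨g, hg⟩ := LinearMap.congr_fun hL _
  have h4 : ev ⟨g, hg⟩ = ∑ i, g (X i) • (Pi.single i 1 : Fin n → ℝ) := by
    ext j
    simp [ev, Finset.sum_apply, Pi.single_apply]
  rw [h4, map_sum] at h3
  have h5 := congrArg Subtype.val h3
  rw [Submodule.coe_sum] at h5
  simp only [map_smul, Submodule.coe_smul] at h5
  exact h5.symm

/-! ### The polynomial kernel RKHS after a linear change of variables -/

/-- If a polynomial curve `t ↦ ∑ t ^ j • v j` stays in a subspace, its coefficients lie there. -/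
theorem coeff_mem_of_forall_sum_pow_smul_mem {V : Type*} [AddCommGroup V] [Module ℝ V]
    (S : Submodule ℝ V) {N : ℕ} (v : ℕ → V)
    (h : ∀ t : ℝ, ∑ j ∈ Finset.range N, t ^ j • v j ∈ S) {j : ℕ} (hj : j < N) : v j ∈ S := by
  rw [← Submodule.Quotient.mk_eq_zero, ← Module.forall_dual_apply_eq_zero_iff ℝ]
  intro φ
  set c : ℕ → ℝ := fun i => φ (Submodule.Quotient.mk (v i)) with hc
  set P : Polynomial ℝ := ∑ i ∈ Finset.range N, Polynomial.monomial i (c i) with hP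
  have hP0 : P = 0 := Polynomial.funext fun t => by
    have h1 : φ (S.mkQ (∑ i ∈ Finset.range N, t ^ i • v i)) = 0 := by
      rw [show S.mkQ _ = 0 from (Submodule.Quotient.mk_eq_zero S).mpr (h t), map_zero]
    rw [map_sum, map_sum] at h1
    simp only [map_smul, smul_eq_mul, Submodule.mkQ_apply] at h1
    rw [hP, Polynomial.eval_finsetSum]
    simpa [hc, mul_comm] using h1
  have h2 : P.coeff j = c j := by
    simp [hP, Polynomial.finsetSum_coeff, Polynomial.coeff_monomial, hj]
  change c j = 0
  rw [← h2, hP0, Polynomial.coeff_zero]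

/-- Differentiating `p`-th powers of affine functions: a space of functions containing
`x ↦ (⟪x, w⟫ + b) ^ p` for all `w ∈ W` contains `∏ ⟪x, wᵢ⟫ * (⟪x, w⟫ + b) ^ (p - k)` for every
`w₁, …, w_k, w ∈ W`, the first-order coefficient along `w + t wᵢ` at each step. -/
theorem prod_inner_mul_pow_mem {E : Type*} [NormedAddCommGroup E] [InnerProductSpace ℝ E]
    {p : ℕ} {b : ℝ} (W : Submodule ℝ E) (S : Submodule ℝ (E → ℝ))
    (hS : ∀ w ∈ W, (fun x => (inner ℝ x w + b) ^ p) ∈ S) (l : List E) (hl : ∀ w ∈ l, w ∈ W)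
    (hp : l.length ≤ p) {w : E} (hw : w ∈ W) :
    (fun x => (l.map (fun u => (inner ℝ x u : ℝ))).prod *
      (inner ℝ x w + b) ^ (p - l.length)) ∈ S := by
  induction l generalizing w with
  | nil => simpa using hS w hw
  | cons u l ih =>
    have hl' : ∀ w ∈ l, w ∈ W := fun w h => hl w (by simp [h])
    have hlen : l.length + 1 ≤ p := by simpa using hp
    obtain ⟨k, hk⟩ : ∃ k, p - l.length = k + 1 := ⟨p - l.length - 1, by omega⟩
    let g : E → ℝ := fun x => (l.map (fun u => (inner ℝ x u : ℝ))).prod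
    have hcoef := coeff_mem_of_forall_sum_pow_smul_mem S (N := k + 2)
      (fun j x => g x * (inner ℝ x u ^ j * (inner ℝ x w + b) ^ (k + 1 - j) * (k + 1).choose j))
      (fun t => by
        have := ih hl' (by omega) (W.add_mem hw (W.smul_mem t (hl u (by simp))))
        rw [hk] at this
        convert this using 1
        ext x
        rw [inner_add_right, inner_smul_right,
          show inner ℝ x w + t * inner ℝ x u + b = t * inner ℝ x u + (inner ℝ x w + b) by ring,
          add_pow, Finset.mul_sum]
        simp only [Finset.sum_apply, Pi.smul_apply, smul_eq_mul, g]
        exact Finset.sum_congr rfl fun j _ => by rw [mul_pow]; ring) (j := 1) (by omega)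
    have hne : ((k : ℝ) + 1) ≠ 0 := by positivity
    have := S.smul_mem ((k : ℝ) + 1)⁻¹ hcoef
    convert this using 1
    ext x
    have hk' : p - (u :: l).length = k := by simp; omega
    simp only [hk', List.map_cons, List.prod_cons, Pi.smul_apply, smul_eq_mul, g, pow_one,
      Nat.choose_one_right, Nat.add_sub_cancel]
    push_cast
    field_simp

section Kernel

variable {d : ℕ}

/-- A space of functions that contains `x ↦ (⟪x, w⟫ + b) ^ p`, `b ≠ 0`, for all `w ∈ W` contains
every polynomial of degree at most `p` that is invariant under translation by `Wᗮ`. -/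
theorem evalFun_mem_of_forall_pow_mem {p : ℕ} {b : ℝ} (hb : b ≠ 0)
    (W : Submodule ℝ (EuclideanSpace ℝ (Fin d))) (S : Submodule ℝ (EuclideanSpace ℝ (Fin d) → ℝ))
    (hS : ∀ w ∈ W, (fun x => (inner ℝ x w + b) ^ p) ∈ S)
    (P : MvPolynomial (Fin d) ℝ) (hP : P.totalDegree ≤ p)
    (hinv : ∀ x, ∀ v ∈ Wᗮ, evalFun d P (x + v) = evalFun d P x) : evalFun d P ∈ S := by
  -- Coordinates of the orthogonal projection to `W` are inner products with vectors of `W`.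
  let a : Fin d → EuclideanSpace ℝ (Fin d) := fun i =>
    W.starProjection (EuclideanSpace.single i 1)
  have ha : ∀ x i, (W.starProjection x) i = inner ℝ x (a i) := fun x i => by
    rw [← Submodule.inner_starProjection_left_eq_right]
    simp [PiLp.inner_apply]
  have hproj : evalFun d P = fun x => MvPolynomial.eval (fun i => inner ℝ x (a i)) P := by
    ext x
    have h1 := hinv (W.starProjection x) (x - W.starProjection x)
      (W.sub_starProjection_mem_orthogonal x)
    rw [add_sub_cancel] at h1
    rw [h1, evalFun_apply]
    simp only [ha]
  have hsum : evalFun d P = ∑ m ∈ P.support,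
      P.coeff m • fun x => ∏ i, (inner ℝ x (a i) : ℝ) ^ m i := by
    rw [hproj]
    ext x
    simp [MvPolynomial.eval_eq']
  rw [hsum]
  refine Submodule.sum_mem _ fun m hm => Submodule.smul_mem _ _ ?_
  set l : List (EuclideanSpace ℝ (Fin d)) := (m.toMultiset.map a).toList with hl
  have hlen : l.length ≤ p := by
    simp only [hl, Multiset.length_toList, Multiset.card_map, Finsupp.card_toMultiset]
    exact (MvPolynomial.le_totalDegree hm).trans hP
  have hmem := prod_inner_mul_pow_mem W S hS l (fun w hw => by
    simp only [hl, Multiset.mem_toList, Multiset.mem_map] at hw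
    obtain ⟨i, -, rfl⟩ := hw
    exact Submodule.starProjection_apply_mem W _) hlen W.zero_mem
  have h2 := S.smul_mem ((b ^ (p - l.length))⁻¹) hmem
  convert h2 using 1
  ext x
  have hprod : (l.map (fun u => (inner ℝ x u : ℝ))).prod = ∏ i, (inner ℝ x (a i) : ℝ) ^ m i := by
    rw [← Multiset.prod_coe, ← Multiset.map_coe, hl, Multiset.coe_toList, Multiset.map_map,
      Finsupp.toMultiset_map, Finsupp.prod_toMultiset,
      Finsupp.prod_mapDomain_index (by simp) (by simp [pow_add]),
      Finsupp.prod_fintype _ _ (by simp)]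
    rfl
  simp only [Pi.smul_apply, smul_eq_mul, hprod, inner_zero_right, zero_add]
  field_simp

/-- Composition of elements of the RKHS with a map, as a linear map. -/
noncomputable def compRKHS (b : NNReal) (p : ℕ)
    (T : EuclideanSpace ℝ (Fin d) → EuclideanSpace ℝ (Fin d)) :
    PolyRKHS d b p →ₗ[ℝ] (EuclideanSpace ℝ (Fin d) → ℝ) where
  toFun F := fun x => F (T x)
  map_add' F G := by ext x; simp
  map_smul' c F := by ext x; simp

@[simp] theorem compRKHS_apply (b : NNReal) (p : ℕ)
    (T : EuclideanSpace ℝ (Fin d) → EuclideanSpace ℝ (Fin d))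
    (F : PolyRKHS d b p) (x : EuclideanSpace ℝ (Fin d)) :
    compRKHS b p T F x = F (T x) := rfl

theorem kerFun_polyRKHS_apply (b : NNReal) (p : ℕ) (z x : EuclideanSpace ℝ (Fin d)) (c : ℝ) :
    RKHS.kerFun (PolyRKHS d b p) z c x = (inner ℝ x z + (b : ℝ)) ^ p * c := by
  rw [RKHS.kerFun_apply, RKHS.OfKernel.kernel_ofKernel]
  simp [polyKernelMatrix, polyKernel]

/-- After composition with a self-adjoint map `T`, the RKHS of the polynomial kernel contains every
polynomial of degree at most `p` that is invariant under translation by `ker T`. -/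
theorem exists_polyRKHS_comp_eq {b : NNReal} (hb : 0 < b) {p : ℕ}
    {T : EuclideanSpace ℝ (Fin d) →ₗ[ℝ] EuclideanSpace ℝ (Fin d)}
    (hT : T.IsSymmetric) (P : MvPolynomial (Fin d) ℝ) (hP : P.totalDegree ≤ p)
    (hinv : ∀ x v, T v = 0 → evalFun d P (x + v) = evalFun d P x) :
    ∃ F : PolyRKHS d b p, ∀ x, F (T x) = evalFun d P x := by
  have hmem : evalFun d P ∈ LinearMap.range (compRKHS b p T) := by
    refine evalFun_mem_of_forall_pow_mem (b := (b : ℝ)) (by exact_mod_cast hb.ne')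
      (LinearMap.range T) _ ?_ P hP fun x v hv => hinv x v ?_
    · rintro _ ⟨z, rfl⟩
      refine ⟨RKHS.kerFun (PolyRKHS d b p) z 1, ?_⟩
      ext x
      rw [compRKHS_apply, kerFun_polyRKHS_apply, mul_one, hT x z]
    · rw [hT.orthogonal_range] at hv
      exact hv
  obtain ⟨F, hF⟩ := hmem
  exact ⟨F, fun x => congrFun hF x⟩

/-- After composition with a self-adjoint map `T` of rank `s`, the functions of the RKHS of the
polynomial kernel lie in a space of polynomials of dimension at most `(s + 1) ^ p`. -/
theorem exists_submodule_polyRKHS_comp_mem (b : NNReal) (p : ℕ)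
    {T : EuclideanSpace ℝ (Fin d) →ₗ[ℝ] EuclideanSpace ℝ (Fin d)}
    (hT : T.IsSymmetric) :
    ∃ S : Submodule ℝ (EuclideanSpace ℝ (Fin d) → ℝ), FiniteDimensional ℝ S ∧ S ≤ polyFun d p ∧
      Module.finrank ℝ S ≤ (Module.finrank ℝ (LinearMap.range T) + 1) ^ p ∧
      ∀ F : PolyRKHS d b p, (fun x => F (T x)) ∈ S := by
  let W := LinearMap.range T
  let e := stdOrthonormalBasis ℝ W
  let ψ : Option (Fin (Module.finrank ℝ W)) → EuclideanSpace ℝ (Fin d) → ℝ := fun o x =>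
    o.elim 1 fun j => inner ℝ x (e j : EuclideanSpace ℝ (Fin d))
  let φ : (Fin p → Option (Fin (Module.finrank ℝ W))) → EuclideanSpace ℝ (Fin d) → ℝ :=
    fun α => ∏ t, ψ (α t)
  let S := Submodule.span ℝ (Set.range φ)
  have hfin : FiniteDimensional ℝ S := FiniteDimensional.span_of_finite ℝ (Set.finite_range φ)
  have hker : ∀ z c, compRKHS b p T (RKHS.kerFun (PolyRKHS d b p) z c) ∈ S := by
    intro z c
    let γ : Option (Fin (Module.finrank ℝ W)) → ℝ := fun o =>
      o.elim (b : ℝ) fun j => inner ℝ (e j : EuclideanSpace ℝ (Fin d)) (T z)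
    have hlin : ∀ x : EuclideanSpace ℝ (Fin d), inner ℝ (T x) z + (b : ℝ) = ∑ o, γ o * ψ o x := by
      intro x
      have h1 : T z = ∑ j, (inner ℝ (e j : EuclideanSpace ℝ (Fin d)) (T z)) •
          (e j : EuclideanSpace ℝ (Fin d)) := by
        have h2 := e.sum_repr' ⟨T z, LinearMap.mem_range_self T z⟩
        have h3 := congrArg Subtype.val h2
        rw [Submodule.coe_sum] at h3
        exact h3.symm
      rw [hT x z, Fintype.sum_option, add_comm]
      congr 1
      · simp [γ, ψ]
      · conv_lhs => rw [h1]
        simp [inner_sum, inner_smul_right, γ, ψ]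
    have : compRKHS b p T (RKHS.kerFun (PolyRKHS d b p) z c) =
        ∑ α : Fin p → Option (Fin (Module.finrank ℝ W)), (c * ∏ t, γ (α t)) • φ α := by
      ext x
      rw [compRKHS_apply, kerFun_polyRKHS_apply, hlin]
      have h4 := Finset.prod_univ_sum (fun _ : Fin p => Finset.univ) (fun _ o => γ o * ψ o x)
      rw [Finset.prod_const, Finset.card_univ, Fintype.card_fin] at h4
      rw [h4, Finset.sum_mul, Fintype.piFinset_univ, Finset.sum_apply]
      refine Finset.sum_congr rfl fun α _ => ?_
      simp only [φ, Pi.smul_apply, smul_eq_mul, Finset.prod_apply, Finset.prod_mul_distrib]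
      ring
    rw [this]
    exact Submodule.sum_mem _ fun α _ =>
      Submodule.smul_mem _ _ (Submodule.subset_span ⟨α, rfl⟩)
  refine ⟨S, hfin, ?_, ?_, fun F => ?_⟩
  · refine Submodule.span_le.mpr ?_
    rintro _ ⟨α, rfl⟩
    have := prod_mem_polyFun (Finset.univ : Finset (Fin p)) (fun t => ψ (α t)) fun t _ => by
      rcases α t with _ | j
      · exact const_mem_polyFun 1 1
      · exact inner_mem_polyFun _
    simpa using this
  · refine (finrank_range_le_card φ).trans ?_
    simp [W]
  · -- `S` is closed for pointwise convergence and the kernel functions span a dense subspace.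
    have hcont : Continuous fun F : PolyRKHS d b p => compRKHS b p T F :=
      continuous_pi fun x => RKHS.continuous_eval (T x)
    have hclosed : IsClosed {F : PolyRKHS d b p | compRKHS b p T F ∈ S} :=
      (Submodule.closed_of_finiteDimensional S).preimage hcont
    have hle : Submodule.span ℝ {RKHS.kerFun (PolyRKHS d b p) z c | (z) (c)} ≤
        S.comap (compRKHS b p T) := by
      refine Submodule.span_le.mpr ?_
      rintro _ ⟨z, c, rfl⟩
      exact hker z c
    have htop := Submodule.topologicalClosure_minimal _ hle hclosed
    rw [RKHS.kerFun_dense] at htop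
    exact htop (Submodule.mem_top (x := F))

end Kernel

/-! ### Kernel ridge regression -/

section Ridge

variable {X H : Type*} [NormedAddCommGroup H] [InnerProductSpace ℝ H] [RKHS ℝ H X ℝ]

/-- Existence for a positive ridge parameter: the minimizer is `∑ aᵢ k(zᵢ, ·)` where `a` solves the
linear system `(K + λ) a = y`, which is uniquely solvable since the Gram matrix `K` is positive
semidefinite. -/
theorem exists_isKernelRidge [CompleteSpace H] {n : ℕ} {lam : ℝ} (hlam : 0 < lam) (Z : Fin n → X)
    (y : Fin n → ℝ) : ∃ F : H, IsKernelRidge lam Z y F := by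
  let k : Fin n → H := fun i => RKHS.kerFun H (Z i) 1
  have hk : ∀ i (F : H), inner ℝ (k i) F = F (Z i) := fun i F => by
    simp [k]
  let comb : (Fin n → ℝ) →ₗ[ℝ] H := Fintype.linearCombination ℝ k
  have hcomb : ∀ a (F : H), inner ℝ (comb a) F = ∑ i, a i * F (Z i) := fun a F => by
    simp only [comb, Fintype.linearCombination_apply, sum_inner, real_inner_smul_left, hk]
  let A : (Fin n → ℝ) →ₗ[ℝ] (Fin n → ℝ) :=
    { toFun := fun a i => comb a (Z i) + lam * a i
      map_add' := fun a a' => by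
        ext i; simp only [map_add, RKHS.coe_add, Pi.add_apply]; ring
      map_smul' := fun c a => by
        ext i
        simp only [map_smul, RKHS.coe_smul, Pi.smul_apply, smul_eq_mul, RingHom.id_apply]
        ring }
  have hinj : Function.Injective A := (injective_iff_map_eq_zero A).mpr fun a ha => by
    have h1 : ∀ i, comb a (Z i) = -(lam * a i) := fun i => by
      have := congrFun ha i
      simp only [A, LinearMap.coe_mk, AddHom.coe_mk, Pi.zero_apply] at this
      linarith
    have h2 := hcomb a (comb a)
    have h3 : ∑ i, a i * comb a (Z i) = -lam * ∑ i, a i ^ 2 := by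
      rw [Finset.mul_sum]
      exact Finset.sum_congr rfl fun i _ => by rw [h1]; ring
    rw [h3] at h2
    have h4 : 0 ≤ inner ℝ (comb a) (comb a) := real_inner_self_nonneg
    have h5 : ∑ i, a i ^ 2 = 0 := le_antisymm
      (by nlinarith) (Finset.sum_nonneg fun _ _ => sq_nonneg _)
    ext i
    have := (Finset.sum_eq_zero_iff_of_nonneg fun i _ => sq_nonneg (a i)).mp h5 i (by simp)
    simpa using this
  obtain ⟨a, ha⟩ := LinearMap.surjective_of_injective hinj y
  refine ⟨comb a, fun G => ?_⟩
  set F := comb a with hF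
  have hres : ∀ i, F (Z i) - y i = -(lam * a i) := fun i => by
    have := congrFun ha i
    simp only [A, LinearMap.coe_mk, AddHom.coe_mk] at this
    linarith
  have hinner : inner ℝ F (G - F) = ∑ i, a i * (G (Z i) - F (Z i)) := by
    rw [hF, hcomb]; simp
  have hnorm : ‖G‖ ^ 2 = ‖F‖ ^ 2 + 2 * inner ℝ F (G - F) + ‖G - F‖ ^ 2 := by
    rw [← norm_add_sq_real, add_sub_cancel]
  have hsum : ∑ i, (G (Z i) - y i) ^ 2 = ∑ i, (F (Z i) - y i) ^ 2
      - 2 * lam * ∑ i, a i * (G (Z i) - F (Z i)) + ∑ i, (G (Z i) - F (Z i)) ^ 2 := by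
    rw [Finset.mul_sum, ← Finset.sum_sub_distrib, ← Finset.sum_add_distrib]
    refine Finset.sum_congr rfl fun i _ => ?_
    have : G (Z i) - y i = (G (Z i) - F (Z i)) + (F (Z i) - y i) := by ring
    rw [this, hres]; ring
  rw [hsum, hnorm, hinner]
  have h1 : 0 ≤ ∑ i, (G (Z i) - F (Z i)) ^ 2 := Finset.sum_nonneg fun _ _ => sq_nonneg _
  nlinarith [mul_nonneg hlam.le (sq_nonneg ‖G - F‖)]

theorem isKernelRidge_zero_of_interpolates {n : ℕ} {Z : Fin n → X} {y : Fin n → ℝ} {F : H}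
    (hF : ∀ i, F (Z i) = y i) : IsKernelRidge 0 Z y F := fun G => by
  simpa [hF] using Finset.sum_nonneg fun i _ => sq_nonneg (G (Z i) - y i)

/-- If some `F₀` interpolates the labels, the training error of a minimizer is at most `λ ‖F₀‖²`. -/
theorem IsKernelRidge.sq_residual_le {n : ℕ} {Z : Fin n → X} {y : Fin n → ℝ} {lam : ℝ}
    (hlam : 0 ≤ lam) {F F₀ : H} (hF : IsKernelRidge lam Z y F) (hF₀ : ∀ i, F₀ (Z i) = y i)
    (i : Fin n) : (F (Z i) - y i) ^ 2 ≤ lam * ‖F₀‖ ^ 2 := by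
  have h := hF F₀
  simp only [hF₀, sub_self, ne_eq, OfNat.ofNat_ne_zero, not_false_eq_true, zero_pow,
    Finset.sum_const_zero, zero_add] at h
  have h1 := Finset.single_le_sum (fun j _ => sq_nonneg (F (Z j) - y j)) (Finset.mem_univ i)
  have h2 : 0 ≤ lam * ‖F‖ ^ 2 := by positivity
  linarith

theorem tendsto_residual_of_isKernelRidge {n : ℕ} {Z : Fin n → X} {y : Fin n → ℝ} {F : ℝ → H}
    {F₀ : H} (hF : ∀ lam, 0 < lam → IsKernelRidge lam Z y (F lam)) (hF₀ : ∀ i, F₀ (Z i) = y i)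
    (i : Fin n) : Tendsto (fun lam => F lam (Z i) - y i) (𝓝[>] 0) (𝓝 0) := by
  have h0 : Tendsto (fun lam : ℝ => √(lam * ‖F₀‖ ^ 2)) (𝓝[>] 0) (𝓝 0) := by
    have : Continuous fun lam : ℝ => √(lam * ‖F₀‖ ^ 2) := by fun_prop
    simpa using (this.tendsto 0).mono_left nhdsWithin_le_nhds
  refine squeeze_zero_norm' ?_ h0
  filter_upwards [self_mem_nhdsWithin] with lam hlam
  exact Real.abs_le_sqrt ((hF lam hlam).sq_residual_le (le_of_lt hlam) hF₀ i)

end Ridge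

/-- The prediction risk of a combination of fixed square integrable functions tends to zero when
the coefficients do. -/
theorem tendsto_predictionRisk_zero {d n : ℕ} {μ : Measure (EuclideanSpace ℝ (Fin d))}
    {f : EuclideanSpace ℝ (Fin d) → ℝ} {h : ℝ → EuclideanSpace ℝ (Fin d) → ℝ}
    {ℓ : Fin n → EuclideanSpace ℝ (Fin d) → ℝ} {c : Fin n → ℝ → ℝ} {l : Filter ℝ}
    (hℓ : ∀ i, Integrable (fun x => ℓ i x ^ 2) μ) (hc : ∀ i, Tendsto (c i) l (𝓝 0))
    (hh : ∀ᶠ t in l, ∀ x, h t x - f x = ∑ i, c i t * ℓ i x) :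
    Tendsto (fun t => predictionRisk μ (h t) f) l (𝓝 0) := by
  have hbound : ∀ᶠ t in l, predictionRisk μ (h t) f ≤
      ENNReal.ofReal (∑ i, c i t ^ 2) * ∫⁻ x, ENNReal.ofReal (∑ i, ℓ i x ^ 2) ∂μ := by
    filter_upwards [hh] with t ht
    rw [predictionRisk, ← lintegral_const_mul' _ _ ENNReal.ofReal_ne_top]
    refine lintegral_mono fun x => ?_
    rw [← ENNReal.ofReal_mul (Finset.sum_nonneg fun _ _ => sq_nonneg _), ht]
    exact ENNReal.ofReal_le_ofReal (Finset.sum_mul_sq_le_sq_mul_sq _ _ _)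
  have hfin : ∫⁻ x, ENNReal.ofReal (∑ i, ℓ i x ^ 2) ∂μ ≠ ⊤ :=
    (integrable_finsetSum _ fun i _ => hℓ i).lintegral_lt_top.ne
  have hc0 : Tendsto (fun t => ∑ i, c i t ^ 2) l (𝓝 0) := by
    simpa using tendsto_finsetSum Finset.univ fun i _ => (hc i).pow 2
  have hlim := ENNReal.Tendsto.mul_const (ENNReal.tendsto_ofReal hc0) (Or.inr hfin)
  rw [ENNReal.ofReal_zero, zero_mul] at hlim
  exact tendsto_of_tendsto_of_tendsto_of_le_of_le' tendsto_const_nhds hlim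
    (Filter.Eventually.of_forall fun _ => bot_le) hbound

/-! ### The expected gradient outer product of a polynomial -/

open scoped MatrixOrder Matrix.Norms.L2Operator in
theorem sqrtTransform_isSymmetric {d : ℕ} (M : Matrix (Fin d) (Fin d) ℝ) :
    (Matrix.toEuclideanLin (CFC.sqrt M)).IsSymmetric :=
  Matrix.isSymmetric_toEuclideanLin_iff.mpr
    (Matrix.nonneg_iff_posSemidef.mp (CFC.sqrt_nonneg M)).isHermitian

open scoped MatrixOrder Matrix.Norms.L2Operator in
theorem sqrtTransform_eq_toEuclideanLin {d : ℕ} (M : Matrix (Fin d) (Fin d) ℝ)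
    (x : EuclideanSpace ℝ (Fin d)) :
    sqrtTransform M x = Matrix.toEuclideanLin (CFC.sqrt M) x := rfl

open scoped MatrixOrder Matrix.Norms.L2Operator in
theorem sq_norm_sqrtTransform {d : ℕ} {M : Matrix (Fin d) (Fin d) ℝ} (hM : M.PosSemidef)
    (v : EuclideanSpace ℝ (Fin d)) :
    ‖sqrtTransform M v‖ ^ 2 = ∑ i, ∑ j, v i * v j * M i j := by
  have h1 : CFC.sqrt M * CFC.sqrt M = M :=
    CFC.sqrt_mul_sqrt_self M (Matrix.nonneg_iff_posSemidef.mpr hM)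
  have h2 : sqrtTransform M (sqrtTransform M v) = WithLp.toLp 2 (M *ᵥ (fun i => v i)) := by
    simp only [sqrtTransform, Matrix.mulVec_mulVec, h1]
  rw [← real_inner_self_eq_norm_sq]
  conv_lhs => rw [sqrtTransform_eq_toEuclideanLin]
  rw [sqrtTransform_isSymmetric, ← sqrtTransform_eq_toEuclideanLin,
    ← sqrtTransform_eq_toEuclideanLin, h2]
  simp only [PiLp.inner_apply, Matrix.mulVec, dotProduct, RCLike.inner_apply, conj_trivial,
    Finset.sum_mul]
  exact Finset.sum_congr rfl fun i _ => Finset.sum_congr rfl fun j _ => by ring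

section Egop

variable {d : ℕ}

theorem sum_mul_gradient_eq_fderiv (f : EuclideanSpace ℝ (Fin d) → ℝ)
    (x v : EuclideanSpace ℝ (Fin d)) : ∑ i, v i * (∇ f x) i = fderiv ℝ f x v := by
  have h : inner ℝ (∇ f x) v = fderiv ℝ f x v := by
    rw [gradient, InnerProductSpace.toDual_symm_apply]
  rw [← h, PiLp.inner_apply]
  simp

theorem continuous_gradient_evalFun (P : MvPolynomial (Fin d) ℝ) :
    Continuous fun x => ∇ (evalFun d P) x :=
  (LinearIsometryEquiv.continuous _).comp ((contDiff_evalFun P).continuous_fderiv (by simp))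

variable {μ : Measure (EuclideanSpace ℝ (Fin d))} {P : MvPolynomial (Fin d) ℝ}

theorem integrable_gradient_mul (hint : Integrable (fun x => ‖∇ (evalFun d P) x‖ ^ 2) μ)
    (i j : Fin d) : Integrable (fun x => (∇ (evalFun d P) x) i * (∇ (evalFun d P) x) j) μ := by
  have hc := continuous_gradient_evalFun P
  have hci : ∀ i : Fin d, Continuous fun x => (∇ (evalFun d P) x) i := fun i => by fun_prop
  refine hint.mono' ((hci i).mul (hci j)).aestronglyMeasurable
    (Filter.Eventually.of_forall fun x => ?_)
  rw [norm_mul, sq]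
  exact mul_le_mul (PiLp.norm_apply_le _ i) (PiLp.norm_apply_le _ j) (norm_nonneg _) (norm_nonneg _)

theorem sum_egop_eq_integral (hint : Integrable (fun x => ‖∇ (evalFun d P) x‖ ^ 2) μ)
    (v : EuclideanSpace ℝ (Fin d)) :
    Integrable (fun x => (fderiv ℝ (evalFun d P) x v) ^ 2) μ ∧
    ∑ i, ∑ j, v i * v j * egop μ (evalFun d P) i j =
      ∫ x, (fderiv ℝ (evalFun d P) x v) ^ 2 ∂μ := by
  have hexp : ∀ x, (fderiv ℝ (evalFun d P) x v) ^ 2 = ∑ i, ∑ j, v i * v j *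
      ((∇ (evalFun d P) x) i * (∇ (evalFun d P) x) j) := fun x => by
    rw [← sum_mul_gradient_eq_fderiv, sq, Finset.sum_mul_sum]
    exact Finset.sum_congr rfl fun i _ => Finset.sum_congr rfl fun j _ => by ring
  have hi := integrable_gradient_mul hint
  simp only [hexp]
  refine ⟨integrable_finsetSum _ fun i _ => integrable_finsetSum _ fun j _ => (hi i j).const_mul _,
    ?_⟩
  rw [integral_finsetSum _ fun i _ => integrable_finsetSum _ fun j _ => (hi i j).const_mul _]
  refine Finset.sum_congr rfl fun i _ => ?_
  rw [integral_finsetSum _ fun j _ => (hi i j).const_mul _]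
  exact Finset.sum_congr rfl fun j _ => by rw [integral_const_mul]; rfl

theorem egop_posSemidef (hint : Integrable (fun x => ‖∇ (evalFun d P) x‖ ^ 2) μ) :
    (egop μ (evalFun d P)).PosSemidef := by
  refine Matrix.PosSemidef.of_dotProduct_mulVec_nonneg ?_ fun v => ?_
  · ext i j
    simp [egop, mul_comm]
  · have h := (sum_egop_eq_integral hint (WithLp.toLp 2 v)).2
    have h0 : 0 ≤ ∫ x, (fderiv ℝ (evalFun d P) x (WithLp.toLp 2 v)) ^ 2 ∂μ :=
      integral_nonneg fun _ => sq_nonneg _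
    rw [← h] at h0
    refine h0.trans_eq ?_
    simp only [dotProduct, Matrix.mulVec, Finset.mul_sum, Pi.star_apply, star_trivial]
    exact Finset.sum_congr rfl fun i _ => Finset.sum_congr rfl fun j _ => by ring

/-- The kernel of `M^{1/2}` consists of the directions along which `f` has no slope. -/
theorem sqrtTransform_egop_eq_zero_iff [IsProbabilityMeasure μ] (hμ : μ ≪ volume)
    (hint : Integrable (fun x => ‖∇ (evalFun d P) x‖ ^ 2) μ) (v : EuclideanSpace ℝ (Fin d)) :
    sqrtTransform (egop μ (evalFun d P)) v = 0 ↔ ∀ x, fderiv ℝ (evalFun d P) x v = 0 := by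
  obtain ⟨hi, hsum⟩ := sum_egop_eq_integral hint v
  rw [← norm_eq_zero, ← sq_eq_zero_iff, sq_norm_sqrtTransform (egop_posSemidef hint), hsum,
    integral_eq_zero_iff_of_nonneg (fun _ => sq_nonneg _) hi]
  refine ⟨fun h => ?_, fun h => Filter.Eventually.of_forall fun x => by simp [h x]⟩
  obtain ⟨Q, hQ⟩ := exists_fderiv_evalFun P v
  by_contra hne
  have hQ0 : evalFun d Q ≠ 0 := fun h0 => hne fun x => by rw [hQ, h0]; rfl
  have hfalse : ∀ᵐ _ ∂μ, False := by
    filter_upwards [hμ.ae_le (ae_evalFun_ne_zero Q hQ0), h] with x h1 h2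
    exact h1 (by rw [← hQ]; simpa using h2)
  exact IsProbabilityMeasure.ne_zero μ (by simpa using hfalse)

/-- A function without slope along `v` is invariant under translation by `v`. -/
theorem evalFun_add_of_fderiv_eq_zero {v : EuclideanSpace ℝ (Fin d)}
    (h : ∀ x, fderiv ℝ (evalFun d P) x v = 0) (x : EuclideanSpace ℝ (Fin d)) :
    evalFun d P (x + v) = evalFun d P x := by
  have hd : Differentiable ℝ (evalFun d P) := (contDiff_evalFun P).differentiable (by simp)
  have hline : ∀ t : ℝ, HasDerivAt (fun t : ℝ => evalFun d P (x + t • v)) 0 t := fun t => by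
    have h1 : HasDerivAt (fun t : ℝ => x + t • v) v t := by
      simpa using ((hasDerivAt_id t).smul_const v).const_add x
    have h2 := (hd (x + t • v)).hasFDerivAt.comp_hasDerivAt t h1
    rwa [h] at h2
  have := is_const_of_deriv_eq_zero (fun t => (hline t).differentiableAt)
    (fun t => (hline t).deriv) 1 0
  simpa using this

/-- The rank of `M^{1/2}` is at most `r` when `f` factors through `U : ℝ^d → ℝ^r`, since `f` has no
slope along `ker U`. -/
theorem finrank_range_sqrtTransform_le [IsProbabilityMeasure μ] (hμ : μ ≪ volume)
    (hint : Integrable (fun x => ‖∇ (evalFun d P) x‖ ^ 2) μ) {r : ℕ}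
    (U : Matrix (Fin r) (Fin d) ℝ) {g : (Fin r → ℝ) → ℝ}
    (hg : ∀ x : EuclideanSpace ℝ (Fin d), evalFun d P x = g (U *ᵥ (fun i => x i)))
    {T : EuclideanSpace ℝ (Fin d) →ₗ[ℝ] EuclideanSpace ℝ (Fin d)}
    (hT : ∀ x, T x = sqrtTransform (egop μ (evalFun d P)) x) :
    Module.finrank ℝ (LinearMap.range T) ≤ r := by
  let U' : EuclideanSpace ℝ (Fin d) →ₗ[ℝ] (Fin r → ℝ) :=
    U.mulVecLin ∘ₗ (WithLp.linearEquiv 2 ℝ (Fin d → ℝ)).toLinearMap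
  have hU' : ∀ x, U' x = U *ᵥ (fun i => x i) := fun x => rfl
  have hle : LinearMap.ker U' ≤ LinearMap.ker T := fun v hv => by
    rw [LinearMap.mem_ker] at hv ⊢
    rw [hT, sqrtTransform_egop_eq_zero_iff hμ hint]
    intro x
    have hd : Differentiable ℝ (evalFun d P) := (contDiff_evalFun P).differentiable (by simp)
    rw [← (hd x).lineDeriv_eq_fderiv, lineDeriv]
    have : (fun t : ℝ => evalFun d P (x + t • v)) = fun _ => evalFun d P x := by
      ext t
      rw [hg, hg, ← hU', ← hU', map_add, map_smul, hv, smul_zero, add_zero]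
    rw [this, deriv_const]
  have h1 := LinearMap.finrank_range_add_finrank_ker T
  have h2 := LinearMap.finrank_range_add_finrank_ker U'
  have h3 := Submodule.finrank_mono hle
  have h4 : Module.finrank ℝ (LinearMap.range U') ≤ r := by
    simpa using Submodule.finrank_le (LinearMap.range U')
  omega

end Egop

/-! ### Exact recovery by kernel ridge regression -/

/-- For `r = 0` the hypothesis `(2 r) ^ p ≤ n` allows `n = 0` if `p ≥ 1`, but then there is no
polynomial to learn: a function that factors through `ℝ^0` is constant. -/
theorem IsLowRankPoly.degree_eq_zero_of_rank_zero {p d : ℕ} {U : Matrix (Fin 0) (Fin d) ℝ}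
    {f : EuclideanSpace ℝ (Fin d) → ℝ} (hf : IsLowRankPoly p U f) : p = 0 := by
  obtain ⟨⟨P, hP, hfP⟩, g, hg⟩ := hf
  have : P = MvPolynomial.C (f 0) := MvPolynomial.funext fun x => by
    have h1 := hfP (WithLp.toLp 2 x)
    rw [hg, Subsingleton.elim (U *ᵥ _) (U *ᵥ fun i => (0 : EuclideanSpace ℝ (Fin d)) i),
      ← hg] at h1
    simpa using h1.symm
  rw [← hP, this, MvPolynomial.totalDegree_C]

/-- The dimension bound `(s + 1) ^ p` is at most `(2 r) ^ p`, which fixes the constant `2 ^ p`. -/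
theorem succ_pow_le_of_le {p r s n : ℕ} (hs : s ≤ r) (h0 : r = 0 → p = 0)
    (hn : (2 : ℝ) ^ p * (r : ℝ) ^ p ≤ n) : (s + 1) ^ p ≤ n := by
  have h1 : ((s + 1 : ℕ) : ℝ) ^ p ≤ (2 : ℝ) ^ p * (r : ℝ) ^ p := by
    rcases Nat.eq_zero_or_pos r with hr | hr
    · simp [h0 hr]
    · rw [← mul_pow]
      gcongr
      have : s + 1 ≤ 2 * r := by omega
      exact_mod_cast this
  exact_mod_cast h1.trans hn

theorem densityLaw_isProbabilityMeasure {d : ℕ} {ρ : EuclideanSpace ℝ (Fin d) → ENNReal}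
    (h : ∫⁻ x, ρ x = 1) : IsProbabilityMeasure (densityLaw ρ) :=
  ⟨by rw [densityLaw, withDensity_apply _ MeasurableSet.univ, Measure.restrict_univ, h]⟩

theorem densityLaw_absolutelyContinuous {d : ℕ} (ρ : EuclideanSpace ℝ (Fin d) → ENNReal) :
    densityLaw ρ ≪ volume :=
  withDensity_absolutelyContinuous _ _

/-- Exact recovery by kernel ridge regression on `M^{1/2} x` from at least `(2 r) ^ p` samples. -/
theorem kernelRidge_recovers {p d r n : ℕ} {b : NNReal} (hb : 0 < b)
    (U : Matrix (Fin r) (Fin d) ℝ) {μ : Measure (EuclideanSpace ℝ (Fin d))}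
    [IsProbabilityMeasure μ] (hμ : μ ≪ volume) {f : EuclideanSpace ℝ (Fin d) → ℝ}
    (hf : IsLowRankPoly p U f) (hint : Integrable (fun x => ‖∇ f x‖ ^ 2) μ)
    (hn : (2 : ℝ) ^ p * (r : ℝ) ^ p ≤ n) :
    ∀ᵐ X ∂(sampleLaw n μ),
      let T := sqrtTransform (egop μ f)
      (∀ lam : ℝ, 0 ≤ lam → ∃ F : PolyRKHS d b p,
        IsKernelRidge lam (fun i => T (X i)) (fun i => f (X i)) F) ∧
      (∀ F : PolyRKHS d b p,
        IsKernelRidge 0 (fun i => T (X i)) (fun i => f (X i)) F → ∀ x, F (T x) = f x) ∧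
      (∀ F : ℝ → PolyRKHS d b p,
        (∀ lam, 0 < lam →
          IsKernelRidge lam (fun i => T (X i)) (fun i => f (X i)) (F lam)) →
        (∀ x, Tendsto (fun lam => F lam (T x)) (𝓝[>] 0) (𝓝 (f x))) ∧
        (Integrable (fun x => ‖x‖ ^ (2 * p)) μ →
          Tendsto (fun lam => predictionRisk μ (fun x => F lam (T x)) f) (𝓝[>] 0) (𝓝 0))) := by
  have h0 : r = 0 → p = 0 := by rintro rfl; exact hf.degree_eq_zero_of_rank_zero
  obtain ⟨⟨P, hP, hfP⟩, g, hg⟩ := hf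
  obtain rfl : f = evalFun d P := funext hfP
  obtain ⟨T, hTsym, hT⟩ : ∃ T : EuclideanSpace ℝ (Fin d) →ₗ[ℝ] EuclideanSpace ℝ (Fin d),
      T.IsSymmetric ∧ ∀ x, sqrtTransform (egop μ (evalFun d P)) x = T x :=
    ⟨_, sqrtTransform_isSymmetric _, sqrtTransform_eq_toEuclideanLin _⟩
  have hrank := finrank_range_sqrtTransform_le hμ hint U hg (T := T) fun x => (hT x).symm
  obtain ⟨F₀, hF₀⟩ := exists_polyRKHS_comp_eq hb hTsym P hP.le fun x v hv =>
    evalFun_add_of_fderiv_eq_zero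
      ((sqrtTransform_egop_eq_zero_iff hμ hint v).mp ((hT v).trans hv)) x
  obtain ⟨S, hSfin, hSpoly, hSrank, hS⟩ := exists_submodule_polyRKHS_comp_mem b p hTsym
  have hSn : Module.finrank ℝ S ≤ n := hSrank.trans (succ_pow_le_of_le hrank h0 hn)
  have hdiff : ∀ F : PolyRKHS d b p, (fun x => F (T x)) - evalFun d P ∈ S := fun F =>
    S.sub_mem (hS F) ((funext hF₀ : (fun x => F₀ (T x)) = _) ▸ hS F₀)
  filter_upwards [ae_exists_lagrange μ hμ hSpoly hSn] with X hX
  obtain ⟨ℓ, hℓS, hℓ⟩ := hX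
  simp only [hT]
  -- The error is determined by the training residuals.
  have hexp : ∀ (F : PolyRKHS d b p) x, F (T x) - evalFun d P x =
      ∑ i, (F (T (X i)) - evalFun d P (X i)) * ℓ i x := fun F x => by
    have := congrFun (hℓ _ (hdiff F)) x
    simpa using this
  refine ⟨fun lam hlam => ?_, fun F hF x => ?_, fun F hF => ?_⟩
  · rcases hlam.eq_or_lt with rfl | hlam
    · exact ⟨F₀, isKernelRidge_zero_of_interpolates fun i => hF₀ _⟩
    · exact exists_isKernelRidge hlam _ _
  · rw [← sub_eq_zero, hexp]
    refine Finset.sum_eq_zero fun i _ => ?_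
    have h1 := hF.sq_residual_le le_rfl (fun i => hF₀ (X i)) i
    rw [zero_mul] at h1
    rw [pow_eq_zero_iff (two_ne_zero) |>.mp (le_antisymm h1 (sq_nonneg _)), zero_mul]
  · have hres := tendsto_residual_of_isKernelRidge hF fun i => hF₀ (X i)
    refine ⟨fun x => ?_, fun hmom => ?_⟩
    · rw [← tendsto_sub_nhds_zero_iff]
      refine Tendsto.congr (fun lam => (hexp (F lam) x).symm) ?_
      simpa using tendsto_finsetSum Finset.univ fun i _ => (hres i).mul_const (ℓ i x)
    · exact tendsto_predictionRisk_zero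
        (fun i => integrable_sq_of_mem_polyFun (hSpoly (hℓS i)) hmom) hres
        (Filter.Eventually.of_forall fun lam x => hexp (F lam) x)

/-! ### A Bayes lower bound with a rotation invariant prior -/

section Sphere

variable {V : Type*} [NormedAddCommGroup V] [InnerProductSpace ℝ V] [FiniteDimensional ℝ V]
  [MeasurableSpace V] [BorelSpace V]

/-- A rotation invariant probability measure on the unit sphere: the law of `θ / ‖θ‖` for `θ`
uniform in the unit ball. -/
theorem exists_invariant_probability_on_sphere [Nontrivial V] :
    ∃ σ : Measure V, IsProbabilityMeasure σ ∧ (∀ᵐ θ ∂σ, ‖θ‖ = 1) ∧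
      ∀ O : V ≃ₗᵢ[ℝ] V, MeasurePreserving O σ σ := by
  let B : Set V := Metric.ball 0 1
  let ν : Measure V := ProbabilityTheory.cond volume B
  let u : V → V := fun θ => ‖θ‖⁻¹ • θ
  have hu : Measurable u := measurable_norm.inv.smul measurable_id
  have hν : IsProbabilityMeasure ν := ProbabilityTheory.cond_isProbabilityMeasure_of_finite
    (Metric.measure_ball_pos volume 0 one_pos).ne' measure_ball_lt_top.ne
  refine ⟨ν.map u, Measure.isProbabilityMeasure_map hu.aemeasurable, ?_, fun O => ?_⟩
  · rw [ae_map_iff hu.aemeasurable (measurableSet_eq_fun measurable_norm measurable_const)]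
    have h0 : ∀ᵐ θ : V, θ ≠ 0 := by
      rw [ae_iff]; simp
    have hac : ν ≪ volume := ProbabilityTheory.cond_absolutelyContinuous
    filter_upwards [hac.ae_le h0] with θ hθ
    rw [norm_smul, norm_inv, norm_norm, inv_mul_cancel₀ (norm_ne_zero_iff.mpr hθ)]
  · have hpre : O ⁻¹' B = B := by
      ext θ; simp [B]
    have hO : MeasurePreserving O ν ν := by
      have := (O.measurePreserving.restrict_preimage (s := B) measurableSet_ball).smul_measure
        (volume B)⁻¹
      rwa [hpre] at this
    have hcomm : O ∘ u = u ∘ O := by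
      ext θ; simp [u]
    refine ⟨O.continuous.measurable, ?_⟩
    rw [Measure.map_map O.continuous.measurable hu, hcomm,
      ← Measure.map_map hu O.continuous.measurable, hO.map_eq]

variable {σ : Measure V} [IsProbabilityMeasure σ]

/-- Under a rotation invariant law on the unit sphere, the expected squared norm of the orthogonal
projection to `K` is `dim K / dim V`: each of the orthonormal directions contributes equally. -/
theorem finrank_mul_lintegral_projection (hσ : ∀ᵐ θ ∂σ, ‖θ‖ = 1)
    (hinv : ∀ O : V ≃ₗᵢ[ℝ] V, MeasurePreserving O σ σ) (K : Submodule ℝ V) :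
    (Module.finrank ℝ V : ENNReal) * ∫⁻ θ, ENNReal.ofReal (‖K.starProjection θ‖ ^ 2) ∂σ =
      Module.finrank ℝ K := by
  let I : V → ENNReal := fun u => ∫⁻ θ, ENNReal.ofReal (inner ℝ u θ ^ 2) ∂σ
  have hmeas : ∀ u : V, Measurable fun θ : V => ENNReal.ofReal (inner ℝ u θ ^ 2) := fun u => by
    fun_prop
  have hI : ∀ u v : V, ‖u‖ = 1 → ‖v‖ = 1 → I u = I v := fun u v hu hv => by
    let O := (Submodule.span ℝ {u - v})ᗮ.reflection
    have hOu : O u = v := Submodule.reflection_sub (hu.trans hv.symm)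
    simp only [I]
    rw [← (hinv O).lintegral_comp (hmeas v)]
    refine lintegral_congr fun θ => ?_
    rw [← hOu, O.inner_map_map]
  have hsum : ∀ L : Submodule ℝ V, ∀ u : V, ‖u‖ = 1 →
      ∫⁻ θ, ENNReal.ofReal (‖L.starProjection θ‖ ^ 2) ∂σ = Module.finrank ℝ L * I u := by
    intro L u hu
    let e := stdOrthonormalBasis ℝ L
    have h1 : ∀ θ, ENNReal.ofReal (‖L.starProjection θ‖ ^ 2) =
        ∑ j, ENNReal.ofReal (inner ℝ (e j : V) θ ^ 2) := fun θ => by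
      rw [← ENNReal.ofReal_sum_of_nonneg fun _ _ => sq_nonneg _]
      congr 1
      have h2 := e.sum_sq_norm_inner_right (L.orthogonalProjectionOnto θ)
      rw [Submodule.starProjection_apply, ← Submodule.coe_norm, ← h2]
      refine Finset.sum_congr rfl fun j _ => ?_
      rw [Real.norm_eq_abs, sq_abs, Submodule.coe_inner, ← Submodule.starProjection_apply,
        ← Submodule.inner_starProjection_left_eq_right,
        Submodule.starProjection_eq_self_iff.mpr (e j).2]
    simp only [h1]
    rw [lintegral_finsetSum _ fun j _ => hmeas _,
      Finset.sum_congr rfl fun j _ => hI (e j : V) u (e.orthonormal.1 j) hu]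
    simp [I]
  obtain ⟨u, hu⟩ : ∃ u : V, ‖u‖ = 1 := hσ.exists
  have htop : (Module.finrank ℝ V : ENNReal) * I u = 1 := by
    have h1 := hsum ⊤ u hu
    rw [finrank_top] at h1
    rw [← h1]
    have : ∀ᵐ θ ∂σ, ENNReal.ofReal (‖(⊤ : Submodule ℝ V).starProjection θ‖ ^ 2) = 1 := by
      filter_upwards [hσ] with θ hθ
      rw [Submodule.starProjection_eq_self_iff.mpr Submodule.mem_top, hθ]
      simp
    rw [lintegral_congr_ae this]
    simp
  rw [hsum K u hu, ← mul_assoc, mul_comm (Module.finrank ℝ V : ENNReal), mul_assoc, htop, mul_one]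

end Sphere

/-- The average risk over a rotation invariant prior on the unit sphere of an `N`-dimensional space
`Φ` of functions, given `n ≤ N / 2` sample points. The guess `h θ` may depend on `θ` only through
the values of `Φ θ` on the sample. The part of `θ` that vanishes on the sample may then be reflected
without changing the guess, which hence misses that part on average. -/
theorem half_le_lintegral_prior {α : Type*} [MeasurableSpace α] (μ : Measure α) [SFinite μ]
    {N n : ℕ} (hN : 1 ≤ N) (hn : 2 * n ≤ N) {σ : Measure (EuclideanSpace ℝ (Fin N))}
    [IsProbabilityMeasure σ] (hσ : ∀ᵐ θ ∂σ, ‖θ‖ = 1)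
    (hinv : ∀ O : EuclideanSpace ℝ (Fin N) ≃ₗᵢ[ℝ] EuclideanSpace ℝ (Fin N),
      MeasurePreserving O σ σ)
    (Φ : EuclideanSpace ℝ (Fin N) →ₗ[ℝ] (α → ℝ))
    (hΦ : ∀ θ, ∫⁻ x, ENNReal.ofReal (Φ θ x ^ 2) ∂μ = ENNReal.ofReal (‖θ‖ ^ 2))
    (X : Fin n → α) (h : EuclideanSpace ℝ (Fin N) → α → ℝ)
    (hdata : ∀ θ θ', (∀ i, Φ θ (X i) = Φ θ' (X i)) → h θ = h θ')
    (hloss : Measurable fun z : EuclideanSpace ℝ (Fin N) × α =>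
      ENNReal.ofReal ((h z.1 z.2 - Φ z.1 z.2) ^ 2)) :
    1 / 2 ≤ ∫⁻ θ, ∫⁻ x, ENNReal.ofReal ((h θ x - Φ θ x) ^ 2) ∂μ ∂σ := by
  let R : EuclideanSpace ℝ (Fin N) → ENNReal := fun θ =>
    ∫⁻ x, ENNReal.ofReal ((h θ x - Φ θ x) ^ 2) ∂μ
  have hR : Measurable R := hloss.lintegral_prod_right'
  let ev : EuclideanSpace ℝ (Fin N) →ₗ[ℝ] (Fin n → ℝ) :=
    { toFun := fun θ i => Φ θ (X i)
      map_add' := fun θ θ' => by ext; simp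
      map_smul' := fun c θ => by ext; simp }
  let K := LinearMap.ker ev
  have hKdim : N ≤ 2 * Module.finrank ℝ K := by
    have h1 := LinearMap.finrank_range_add_finrank_ker ev
    have h2 := Submodule.finrank_le (LinearMap.range ev)
    simp only [finrank_euclideanSpace, Module.finrank_fintype_fun_eq_card,
      Fintype.card_fin] at h1 h2
    simp only [K]
    omega
  have hproj := finrank_mul_lintegral_projection hσ hinv K
  -- The reflection in `Kᗮ` negates the component in `K` and fixes the rest.
  let O := Kᗮ.reflection
  have hΦO : ∀ θ x, Φ (O θ) x = Φ θ x - 2 * Φ (K.starProjection θ) x := fun θ x => by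
    have hOθ : O θ = θ - (2 : ℝ) • K.starProjection θ := by
      simp only [O]
      rw [Submodule.reflection_orthogonal_apply, Submodule.reflection_apply, two_smul, two_smul]
      abel
    rw [hOθ, map_sub, map_smul]; simp
  have hhO : ∀ θ, h (O θ) = h θ := fun θ => hdata _ _ fun i => by
    have h1 : ev (K.starProjection θ) = 0 := K.starProjection_apply_mem θ
    have h2 : Φ (K.starProjection θ) (X i) = 0 := congrFun h1 i
    rw [hΦO, h2, mul_zero, sub_zero]
  have hRO : ∀ θ, 2 * ENNReal.ofReal (‖K.starProjection θ‖ ^ 2) ≤ R θ + R (O θ) := fun θ => by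
    have hm : Measurable fun x => ENNReal.ofReal ((h θ x - Φ θ x) ^ 2) :=
      hloss.comp (measurable_prodMk_left (x := θ))
    simp only [R]
    rw [← lintegral_add_left hm, ← hΦ, ← lintegral_const_mul' _ _ (by simp)]
    refine lintegral_mono fun x => ?_
    have h2 : (2 : ENNReal) * ENNReal.ofReal (Φ (K.starProjection θ) x ^ 2) =
        ENNReal.ofReal (2 * Φ (K.starProjection θ) x ^ 2) := by
      rw [ENNReal.ofReal_mul zero_le_two, ENNReal.ofReal_ofNat]
    rw [hhO, hΦO, h2, ← ENNReal.ofReal_add (sq_nonneg _) (sq_nonneg _)]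
    refine ENNReal.ofReal_le_ofReal ?_
    nlinarith [sq_nonneg (h θ x - Φ θ x + Φ (K.starProjection θ) x)]
  have h2 : 2 * ∫⁻ θ, ENNReal.ofReal (‖K.starProjection θ‖ ^ 2) ∂σ ≤ 2 * ∫⁻ θ, R θ ∂σ := by
    rw [← lintegral_const_mul' _ _ (by simp)]
    refine (lintegral_mono hRO).trans_eq ?_
    rw [lintegral_add_left hR, (hinv O).lintegral_comp hR, two_mul]
  have h3 : ∫⁻ θ, ENNReal.ofReal (‖K.starProjection θ‖ ^ 2) ∂σ ≤ ∫⁻ θ, R θ ∂σ :=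
    (ENNReal.mul_le_mul_iff_right (by simp) (by simp)).mp h2
  refine le_trans ?_ h3
  rw [finrank_euclideanSpace, Fintype.card_fin] at hproj
  have hN0 : (N : ENNReal) ≠ 0 := by exact_mod_cast (by omega : N ≠ 0)
  rw [ENNReal.div_le_iff (by simp) (by simp),
    ← ENNReal.mul_le_mul_iff_right hN0 (ENNReal.natCast_ne_top N), mul_one, ← mul_assoc, hproj,
    mul_comm]
  exact_mod_cast hKdim

/-- A minimax lower bound for the estimation of an element of the unit sphere of an
`N`-dimensional space of functions from `n ≤ N / 2` noiseless samples. -/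
theorem exists_half_le_lintegral_risk {α : Type*} [MeasurableSpace α] (μ : Measure α)
    [IsProbabilityMeasure μ] {N n : ℕ} (hN : 1 ≤ N) (hn : 2 * n ≤ N)
    (Φ : EuclideanSpace ℝ (Fin N) →ₗ[ℝ] (α → ℝ)) (hmeas : ∀ θ, Measurable (Φ θ))
    (hΦ : ∀ θ, ∫⁻ x, ENNReal.ofReal (Φ θ x ^ 2) ∂μ = ENNReal.ofReal (‖θ‖ ^ 2))
    (A : (Fin n → α × ℝ) → α → ℝ) (hA : Measurable (Function.uncurry A)) :
    ∃ θ, ‖θ‖ = 1 ∧ 1 / 2 ≤ ∫⁻ X, ∫⁻ x,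
      ENNReal.ofReal ((A (fun i => (X i, Φ θ (X i))) x - Φ θ x) ^ 2) ∂μ
        ∂Measure.pi (fun _ : Fin n => μ) := by
  have : Nonempty (Fin N) := ⟨⟨0, hN⟩⟩
  obtain ⟨σ, hσp, hσ, hinv⟩ :=
    exists_invariant_probability_on_sphere (V := EuclideanSpace ℝ (Fin N))
  have hΦm : Measurable fun z : EuclideanSpace ℝ (Fin N) × α => Φ z.1 z.2 := by
    have : ∀ z : EuclideanSpace ℝ (Fin N) × α,
        Φ z.1 z.2 = ∑ a, z.1 a * Φ (EuclideanSpace.single a 1) z.2 := fun z => by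
      have h1 : z.1 = ∑ a, z.1 a • EuclideanSpace.single a (1 : ℝ) := by
        ext b; simp [Pi.single_apply]
      conv_lhs => rw [h1, map_sum]
      simp [Finset.sum_apply]
    simp only [this]
    refine Finset.measurable_sum _ fun a _ => Measurable.mul ?_ ((hmeas _).comp measurable_snd)
    exact (by fun_prop : Measurable fun θ : EuclideanSpace ℝ (Fin N) => θ a).comp measurable_fst
  have hloss : Measurable fun z : (EuclideanSpace ℝ (Fin N) × (Fin n → α)) × α =>
      ENNReal.ofReal ((A (fun i => (z.1.2 i, Φ z.1.1 (z.1.2 i))) z.2 - Φ z.1.1 z.2) ^ 2) := by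
    have hD : Measurable fun z : (EuclideanSpace ℝ (Fin N) × (Fin n → α)) × α =>
        fun i => (z.1.2 i, Φ z.1.1 (z.1.2 i)) := measurable_pi_iff.mpr fun i => by
      have hXi : Measurable fun z : (EuclideanSpace ℝ (Fin N) × (Fin n → α)) × α => z.1.2 i :=
        (measurable_pi_apply i).comp (measurable_snd.comp measurable_fst)
      exact hXi.prodMk (hΦm.comp ((measurable_fst.comp measurable_fst).prodMk hXi))
    have h1 := hA.comp (hD.prodMk measurable_snd)
    have h2 := hΦm.comp ((measurable_fst.comp measurable_fst).prodMk measurable_snd :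
      Measurable fun z : (EuclideanSpace ℝ (Fin N) × (Fin n → α)) × α => (z.1.1, z.2))
    exact ((h1.sub h2).pow_const 2).ennreal_ofReal
  let R : EuclideanSpace ℝ (Fin N) → (Fin n → α) → ENNReal := fun θ X =>
    ∫⁻ x, ENNReal.ofReal ((A (fun i => (X i, Φ θ (X i))) x - Φ θ x) ^ 2) ∂μ
  have hR : Measurable (Function.uncurry R) := hloss.lintegral_prod_right'
  have hX : ∀ X, 1 / 2 ≤ ∫⁻ θ, R θ X ∂σ := fun X =>
    half_le_lintegral_prior μ hN hn hσ hinv Φ hΦ X (fun θ => A fun i => (X i, Φ θ (X i)))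
      (fun θ θ' hθ => by simp only [hθ])
      (hloss.comp ((measurable_fst.prodMk measurable_const).prodMk measurable_snd :
        Measurable fun z : EuclideanSpace ℝ (Fin N) × α => ((z.1, X), z.2)))
  have hswap : 1 / 2 ≤ ∫⁻ θ, ∫⁻ X, R θ X ∂Measure.pi (fun _ : Fin n => μ) ∂σ := by
    rw [lintegral_lintegral_swap hR.aemeasurable]
    calc (1 / 2 : ENNReal) = ∫⁻ _, 1 / 2 ∂Measure.pi (fun _ : Fin n => μ) := by
          rw [lintegral_const, measure_univ, mul_one]
      _ ≤ _ := lintegral_mono hX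
  by_contra! hcon
  have hlt : ∀ᵐ θ ∂σ, ∫⁻ X, R θ X ∂Measure.pi (fun _ : Fin n => μ) ≤ 1 / 2 := by
    filter_upwards [hσ] with θ hθ using (hcon θ hθ).le
  have hfin : ∫⁻ θ, ∫⁻ X, R θ X ∂Measure.pi (fun _ : Fin n => μ) ∂σ ≠ ⊤ := by
    refine ne_top_of_le_ne_top (b := 1 / 2) (by simp) ((lintegral_mono_ae hlt).trans_eq ?_)
    rw [lintegral_const, measure_univ, mul_one]
  obtain ⟨θ, hθN, hθ⟩ := exists_notMem_null_lintegral_le hfin (ae_iff.mp hσ)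
  exact absurd (hswap.trans hθ) (not_le.mpr (hcon θ (not_not.mp hθN)))

/-! ### Homogeneous polynomials of low rank -/

/-- Orthonormal coordinates for a finite-dimensional space of square integrable functions. -/
theorem exists_linearEquiv_lintegral_sq_eq {α : Type*} [MeasurableSpace α] (μ : Measure α)
    {V : Type*} [AddCommGroup V] [Module ℝ V] [FiniteDimensional ℝ V] (J : V →ₗ[ℝ] (α → ℝ))
    (hJ : ∀ v, MemLp (J v) 2 μ) (hinj : ∀ v, J v =ᵐ[μ] 0 → v = 0) :
    ∃ Θ : EuclideanSpace ℝ (Fin (Module.finrank ℝ V)) ≃ₗ[ℝ] V,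
      ∀ θ, ∫⁻ x, ENNReal.ofReal (J (Θ θ) x ^ 2) ∂μ = ENNReal.ofReal (‖θ‖ ^ 2) := by
  let Ψ : V →ₗ[ℝ] Lp ℝ 2 μ :=
    { toFun := fun v => (hJ v).toLp
      map_add' := fun v w => by
        rw [← MemLp.toLp_add]
        exact MemLp.toLp_congr _ _ (by rw [map_add])
      map_smul' := fun c v => by
        rw [RingHom.id_apply, ← MemLp.toLp_const_smul]
        exact MemLp.toLp_congr _ _ (by rw [map_smul]) }
  have hΨ : Function.Injective Ψ := (injective_iff_map_eq_zero Ψ).mpr fun v hv =>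
    hinj v ((MemLp.toLp_eq_toLp_iff (hJ v) MemLp.zero').mp (hv.trans (MemLp.toLp_zero _).symm))
  let eV := LinearEquiv.ofInjective Ψ hΨ
  let e : EuclideanSpace ℝ (Fin (Module.finrank ℝ V)) ≃ₗᵢ[ℝ] LinearMap.range Ψ :=
    ((stdOrthonormalBasis ℝ (LinearMap.range Ψ)).reindex
      (finCongr (LinearMap.finrank_range_of_inj hΨ))).repr.symm
  refine ⟨e.toLinearEquiv.trans eV.symm, fun θ => ?_⟩
  set v := (e.toLinearEquiv.trans eV.symm) θ with hv
  have h1 : Ψ v = (e θ : Lp ℝ 2 μ) := by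
    have : eV v = e θ := by simp [hv]
    exact congrArg Subtype.val this
  have h2 : ‖θ‖ ^ 2 = ∫ x, J v x ^ 2 ∂μ := by
    rw [← e.norm_map θ, Submodule.coe_norm, ← h1, ← real_inner_self_eq_norm_sq, L2.inner_def]
    refine integral_congr_ae ?_
    filter_upwards [(hJ v).coeFn_toLp] with x hx
    have hx' : (Ψ v : α → ℝ) x = J v x := hx
    simp [hx', sq]
  rw [h2, ofReal_integral_eq_lintegral_ofReal (hJ v).integrable_sq
    (Filter.Eventually.of_forall fun x => sq_nonneg _)]

theorem pow_le_factorial_mul_multichoose (r p : ℕ) : r ^ p ≤ p.factorial * r.multichoose p := by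
  rw [Nat.multichoose_eq, ← Nat.ascFactorial_eq_factorial_mul_choose']
  exact Nat.pow_succ_le_ascFactorial r p

/-- The homogeneous polynomials of degree `p` in `r` variables, parametrized by their coefficients
on the monomials, which are indexed by the multisets of `p` variables. -/
noncomputable def homogeneousOfCoeffs (r p : ℕ) :
    (Sym (Fin r) p → ℝ) →ₗ[ℝ] MvPolynomial (Fin r) ℝ :=
  Fintype.linearCombination ℝ fun s : Sym (Fin r) p =>
    MvPolynomial.monomial (Multiset.toFinsupp (s : Multiset (Fin r))) 1

theorem homogeneousOfCoeffs_injective (r p : ℕ) :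
    Function.Injective (homogeneousOfCoeffs r p) := by
  have h : LinearIndependent ℝ fun s : Sym (Fin r) p =>
      (MvPolynomial.monomial (Multiset.toFinsupp (s : Multiset (Fin r))) 1 :
        MvPolynomial (Fin r) ℝ) := by
    have := (MvPolynomial.basisMonomials (Fin r) ℝ).linearIndependent.comp
      (fun s : Sym (Fin r) p => Multiset.toFinsupp (s : Multiset (Fin r)))
      (Multiset.toFinsupp.injective.comp Subtype.val_injective)
    simpa [Function.comp_def] using this
  exact linearIndependent_iff_injective_fintypeLinearCombination.mp h

theorem homogeneousOfCoeffs_isHomogeneous {r p : ℕ} (c : Sym (Fin r) p → ℝ) :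
    (homogeneousOfCoeffs r p c).IsHomogeneous p := by
  rw [homogeneousOfCoeffs, Fintype.linearCombination_apply]
  refine MvPolynomial.IsHomogeneous.sum _ _ _ fun s _ => ?_
  rw [MvPolynomial.smul_monomial]
  refine MvPolynomial.isHomogeneous_monomial _ ?_
  refine (Finsupp.card_toMultiset _).symm.trans ?_
  rw [Multiset.toFinsupp_toMultiset]
  exact s.2

section LinearChange

variable {d r : ℕ} (U : Matrix (Fin r) (Fin d) ℝ)

/-- The polynomial `x ↦ P (U x)`. -/
noncomputable def compMatrix : MvPolynomial (Fin r) ℝ →ₐ[ℝ] MvPolynomial (Fin d) ℝ :=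
  MvPolynomial.aeval fun i => ∑ j, MvPolynomial.C (U i j) * MvPolynomial.X j

theorem eval_compMatrix (P : MvPolynomial (Fin r) ℝ) (x : Fin d → ℝ) :
    MvPolynomial.eval x (compMatrix U P) = MvPolynomial.eval (U *ᵥ x) P := by
  induction P using MvPolynomial.induction_on with
  | C a => simp [compMatrix]
  | add P Q hP hQ => simp [hP, hQ]
  | mul_X P i hP =>
    rw [map_mul, map_mul, map_mul, hP, MvPolynomial.eval_X]
    congr 1
    simp [compMatrix, Matrix.mulVec, dotProduct]

theorem compMatrix_isHomogeneous {p : ℕ} {P : MvPolynomial (Fin r) ℝ} (hP : P.IsHomogeneous p) :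
    (compMatrix U P).IsHomogeneous p := by
  have := hP.aeval (fun i => ∑ j, MvPolynomial.C (U i j) * MvPolynomial.X j) (n := 1) fun i =>
    MvPolynomial.IsHomogeneous.sum _ _ _ fun j _ => by
      simpa using (MvPolynomial.isHomogeneous_C (Fin d) (U i j)).mul
        (MvPolynomial.isHomogeneous_X ℝ j)
  simpa [compMatrix] using this

variable {U} in
theorem compMatrix_eq_zero (hU : U.rank = r) {P : MvPolynomial (Fin r) ℝ}
    (hP : compMatrix U P = 0) : P = 0 := by
  have hsurj : Function.Surjective U.mulVecLin := by
    rw [← LinearMap.range_eq_top]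
    refine Submodule.eq_top_of_finrank_eq ?_
    rw [Module.finrank_fintype_fun_eq_card, Fintype.card_fin]
    exact hU
  refine MvPolynomial.funext fun y => ?_
  obtain ⟨x, rfl⟩ := hsurj y
  rw [Matrix.mulVecLin_apply, ← eval_compMatrix, hP, map_zero, map_zero]

end LinearChange

/-- No estimator succeeds on all polynomials of degree `p` of rank `r` from at most
`r ^ p / (2 p!)` samples: the homogeneous ones form a space of dimension at least `r ^ p / p!`. -/
theorem exists_isLowRankPoly_half_le_risk {p d r n : ℕ} {U : Matrix (Fin r) (Fin d) ℝ}
    (hr : 1 ≤ r) (hU : U.rank = r) {μ : Measure (EuclideanSpace ℝ (Fin d))}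
    [IsProbabilityMeasure μ] (hμ : μ ≪ volume) (hmom : Integrable (fun x => ‖x‖ ^ (2 * p)) μ)
    (hn : 2 * p.factorial * n ≤ r ^ p)
    (A : (Fin n → EuclideanSpace ℝ (Fin d) × ℝ) → EuclideanSpace ℝ (Fin d) → ℝ)
    (hA : Measurable (Function.uncurry A)) :
    ∃ f : EuclideanSpace ℝ (Fin d) → ℝ, IsLowRankPoly p U f ∧
      predictionRisk μ (fun _ => 0) f = 1 ∧
      1 / 2 ≤ ∫⁻ X, predictionRisk μ (A fun i => (X i, f (X i))) f ∂(sampleLaw n μ) := by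
  let V := Sym (Fin r) p → ℝ
  let J : V →ₗ[ℝ] (EuclideanSpace ℝ (Fin d) → ℝ) :=
    evalFun d ∘ₗ (compMatrix U).toLinearMap ∘ₗ homogeneousOfCoeffs r p
  have hJc : ∀ c, J c = evalFun d (compMatrix U (homogeneousOfCoeffs r p c)) := fun c => rfl
  have hhom := fun c : V => compMatrix_isHomogeneous U (homogeneousOfCoeffs_isHomogeneous c)
  have hJpoly : ∀ c, J c ∈ polyFun d p := fun c =>
    mem_polyFun.mpr ⟨_, (hhom c).totalDegree_le, rfl⟩
  have hzero : ∀ c : V, compMatrix U (homogeneousOfCoeffs r p c) = 0 → c = 0 := fun c hc =>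
    homogeneousOfCoeffs_injective r p ((compMatrix_eq_zero hU hc).trans (map_zero _).symm)
  have hinj : ∀ c, J c =ᵐ[μ] 0 → c = 0 := fun c hc => by
    refine hzero c ?_
    by_contra hne
    have hne' : evalFun d (compMatrix U (homogeneousOfCoeffs r p c)) ≠ 0 := fun h0 => hne
      (MvPolynomial.funext fun x => by simpa using congrFun h0 (WithLp.toLp 2 x))
    have hfalse : ∀ᵐ _ ∂μ, False := by
      filter_upwards [hc, hμ.ae_le (ae_evalFun_ne_zero _ hne')] with x h1 h2 using h2 h1
    exact IsProbabilityMeasure.ne_zero μ (by simpa using hfalse)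
  obtain ⟨Θ, hΘ⟩ := exists_linearEquiv_lintegral_sq_eq μ J
    (fun c => (memLp_two_iff_integrable_sq
      (continuous_of_mem_polyFun (hJpoly c)).aestronglyMeasurable).mpr
        (integrable_sq_of_mem_polyFun (hJpoly c) hmom)) hinj
  have hdim : Module.finrank ℝ V = r.multichoose p := by
    simp [V, Sym.card_sym_eq_multichoose]
  have hpow := pow_le_factorial_mul_multichoose r p
  have hfact := p.factorial_pos
  have hN : 1 ≤ Module.finrank ℝ V := by
    rw [hdim]
    by_contra h
    rw [Nat.lt_one_iff.mp (not_le.mp h), mul_zero] at hpow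
    exact (Nat.pow_pos hr (n := p)).not_ge hpow
  have hnN : 2 * n ≤ Module.finrank ℝ V := by
    rw [hdim]
    refine Nat.le_of_mul_le_mul_left ?_ hfact
    calc p.factorial * (2 * n) = 2 * p.factorial * n := by ring
      _ ≤ _ := hn.trans hpow
  obtain ⟨θ, hθ, hrisk⟩ := exists_half_le_lintegral_risk μ hN hnN (J ∘ₗ Θ.toLinearMap)
    (fun θ => (continuous_of_mem_polyFun (hJpoly (Θ θ))).measurable) hΘ A hA
  refine ⟨J (Θ θ), ⟨⟨_, (hhom (Θ θ)).totalDegree fun h0 => ?_, fun x => rfl⟩,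
    fun y => MvPolynomial.eval y (homogeneousOfCoeffs r p (Θ θ)), fun x => ?_⟩, ?_, hrisk⟩
  · have : θ = 0 := Θ.map_eq_zero_iff.mp (hzero _ h0)
    simp [this] at hθ
  · rw [hJc, evalFun_apply, eval_compMatrix]
  · have := hΘ θ
    rw [hθ] at this
    simpa [predictionRisk] using this

/-! ### Upper and lower bounds combined -/

theorem mainTheorem6 (p : ℕ) :
    ∃ b : NNReal, 0 < b ∧ ∃ c C : ℝ, 0 < c ∧ 0 < C ∧
      ∀ (d r : ℕ) (U : Matrix (Fin r) (Fin d) ℝ)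
        (ρ : EuclideanSpace ℝ (Fin d) → ENNReal), Measurable ρ → ∫⁻ x, ρ x = 1 →
        -- upper bound: kernel ridge regression on `(M^{1/2} X, f(X))` with `n ≥ C r^p` samples
        (∀ f : EuclideanSpace ℝ (Fin d) → ℝ, IsLowRankPoly p U f →
          Integrable (fun x => ‖∇ f x‖ ^ 2) (densityLaw ρ) →
          ∀ n : ℕ, C * (r : ℝ) ^ p ≤ n →
          ∀ᵐ X ∂(sampleLaw n (densityLaw ρ)),
            let T := sqrtTransform (egop (densityLaw ρ) f)
            (∀ lam : ℝ, 0 ≤ lam → ∃ F : PolyRKHS d b p,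
              IsKernelRidge lam (fun i => T (X i)) (fun i => f (X i)) F) ∧
            (∀ F : PolyRKHS d b p,
              IsKernelRidge 0 (fun i => T (X i)) (fun i => f (X i)) F → ∀ x, F (T x) = f x) ∧
            (∀ F : ℝ → PolyRKHS d b p,
              (∀ lam, 0 < lam →
                IsKernelRidge lam (fun i => T (X i)) (fun i => f (X i)) (F lam)) →
              (∀ x, Tendsto (fun lam => F lam (T x)) (𝓝[>] 0) (𝓝 (f x))) ∧
              (Integrable (fun x => ‖x‖ ^ (2 * p)) (densityLaw ρ) →
                Tendsto (fun lam => predictionRisk (densityLaw ρ) (fun x => F lam (T x)) f)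
                  (𝓝[>] 0) (𝓝 0)))) ∧
        -- minimax lower bound: no estimator succeeds on the whole class with `n ≤ c r^p` samples
        (1 ≤ r → U.rank = r → Integrable (fun x => ‖x‖ ^ (2 * p)) (densityLaw ρ) →
          ∀ n : ℕ, (n : ℝ) ≤ c * (r : ℝ) ^ p →
          ∀ A : (Fin n → EuclideanSpace ℝ (Fin d) × ℝ) → EuclideanSpace ℝ (Fin d) → ℝ,
            Measurable (Function.uncurry A) →
            ∃ f : EuclideanSpace ℝ (Fin d) → ℝ, IsLowRankPoly p U f ∧
              predictionRisk (densityLaw ρ) (fun _ => 0) f = 1 ∧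
              1 / 2 ≤ ∫⁻ X, predictionRisk (densityLaw ρ) (A fun i => (X i, f (X i))) f
                ∂(sampleLaw n (densityLaw ρ))) := by
  -- Any `b > 0` works; `b = 0` would leave only homogeneous polynomials in the RKHS.
  refine ⟨1, one_pos, 1 / (2 * p.factorial), 2 ^ p, by positivity, by positivity, ?_⟩
  intro d r U ρ _ hρ
  have hprob : IsProbabilityMeasure (densityLaw ρ) := densityLaw_isProbabilityMeasure hρ
  refine ⟨fun f hf hint n hn => ?_, fun hr hU hmom n hn A hA => ?_⟩
  · exact kernelRidge_recovers one_pos U (densityLaw_absolutelyContinuous ρ) hf hint hn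
  · refine exists_isLowRankPoly_half_le_risk hr hU (densityLaw_absolutelyContinuous ρ) hmom ?_
      A hA
    rw [one_div, ← div_eq_inv_mul, le_div_iff₀ (by positivity)] at hn
    have h : (n : ℝ) * (2 * p.factorial) = (2 * p.factorial * n : ℕ) := by push_cast; ring
    rw [h] at hn
    exact_mod_cast hn
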